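/- Let $L$ be a first-order language with an arbitrary set of sorts (the one-sorted case included), and let $M$ be an $L$-structure with countable underlying set (the disjoint union of its sorts) and with at least one infinite sort. Suppose that $M$ is saturated: for every finite $E\subseteq M$, every sort $s$ and every family $\mathcal S$ of $E$-definable subsets of the sort $M_s$, if $\mathcal S$ has the finite intersection property, then $\bigcap\mathcal S\neq\emptyset$. For a set $A$ of elements of a structure $N$, let $\mathrm{acl}(A)$ be the union of the finite $A$-definable subsets of the sorts of $N$. Let $M^{\mathrm{eq}}$ be the multi-sorted structure obtained from $M$ by adding, for every finite product $M_{s_1}\times\dots\times M_{s_n}$ of sorts and every $\emptyset$-definable equivalence relation $\mathcal E$ on it, a new sort $(M_{s_1}\times\dots\times M_{s_n})/\mathcal E$ together with the quotient map; $\mathrm{Aut}(M)$ acts on $M^{\mathrm{eq}}$ in the natural way. Let $\mathrm{acl}^{\mathrm{eq}}(\emptyset)$ denote the algebraic closure of $\emptyset$ in $M^{\mathrm{eq}}$, and let $\mathrm{Aut}(M/\mathrm{acl}(\emptyset))$ be the group of automorphisms of $M$ that fix every element of $\mathrm{acl}(\emptyset)$. Then there exist $f,g\in\mathrm{Aut}(M/\mathrm{acl}(\emptyset))$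 such that $F=\langle f,g\rangle$ is the free group on $f,g$, and every non-identity element of $F$ fixes no element of $M^{\mathrm{eq}}\setminus\mathrm{acl}^{\mathrm{eq}}(\emptyset)$. -/

import Mathlib

/-! # Multi-sorted first-order logic, algebraic closure, saturation, automorphisms and `M^eq` -/

universe u v w

/-- A many-sorted first-order language with set of sorts `S` (of any cardinality): function symbols
`s₁ × ⋯ × sₙ → s` and relation symbols on `s₁ × ⋯ × sₙ`. One-sorted logic is the case where `S`
has one element. -/
structure MSLanguage (S : Type u) where
  Fn : (n : ℕ) → (Fin n → S) → S → Type v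
  Rel : (n : ℕ) → (Fin n → S) → Type v

namespace MSLanguage

/-- An interpretation of the language `L` in a family of sets `M s`, one for each sort `s`. -/
class Structure {S : Type u} (L : MSLanguage.{u, v} S) (M : S → Type w) where
  funMap : {n : ℕ} → {σ : Fin n → S} → {s : S} → L.Fn n σ s → ((i : Fin n) → M (σ i)) → M s
  RelMap : {n : ℕ} → {σ : Fin n → S} → L.Rel n σ → ((i : Fin n) → M (σ i)) → Prop

/-- Add one variable (called `none`), of sort `s`, to a family of sorted variables. -/
def extend {S : Type u} {α : Type} (σ : α → S) (s : S) : Option α → S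
  | none => s
  | some a => σ a

/-- Extend an assignment `v` by giving the new variable the value `x`. -/
def extendVal {S : Type u} {M : S → Type w} {α : Type} {σ : α → S} {s : S}
    (x : M s) (v : (a : α) → M (σ a)) : (a : Option α) → M (extend σ s a)
  | none => x
  | some a => v a

/-- The assignment to two disjoint families of variables given by two tuples. -/
def pairVal {S : Type u} {M : S → Type w} {α β : Type} {σ : α → S} {τ : β → S}
    (x : (a : α) → M (σ a)) (y : (b : β) → M (τ b)) :
    (c : α ⊕ β) → M (Sum.elim σ τ c)
  | Sum.inl a => x a
  | Sum.inr b => y b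

/-- Terms of each sort, in the variables `a : α`, where `a` has sort `σ a`. -/
inductive Term {S : Type u} (L : MSLanguage.{u, v} S) {α : Type} (σ : α → S) :
    S → Type (max u v) where
  | var (a : α) : Term L σ (σ a)
  | func {n : ℕ} {τ : Fin n → S} {s : S} (f : L.Fn n τ s) (ts : (i : Fin n) → Term L σ (τ i)) :
      Term L σ s

/-- First-order formulas whose free variables are among the `a : α`, where `a` has sort `σ a`.
The remaining connectives and `∃` are definable from these, classically. -/
inductive Formula {S : Type u} (L : MSLanguage.{u, v} S) :
    (α : Type) → (α → S) → Type (max 1 u v) where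
  | falsum {α : Type} {σ : α → S} : Formula L α σ
  | equal {α : Type} {σ : α → S} {s : S} (t₁ t₂ : Term L σ s) : Formula L α σ
  | rel {α : Type} {σ : α → S} {n : ℕ} {τ : Fin n → S} (R : L.Rel n τ)
      (ts : (i : Fin n) → Term L σ (τ i)) : Formula L α σ
  | imp {α : Type} {σ : α → S} (φ ψ : Formula L α σ) : Formula L α σ
  | all {α : Type} {σ : α → S} (s : S) (φ : Formula L (Option α) (extend σ s)) : Formula L α σ

section Semantics

variable {S : Type u} {L : MSLanguage.{u, v} S} {M : S → Type w} [L.Structure M]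

/-- The value of a term under an assignment. -/
def Term.realize {α : Type} {σ : α → S} (v : (a : α) → M (σ a)) : {s : S} → Term L σ s → M s
  | _, .var a => v a
  | _, .func f ts => Structure.funMap f fun i => (ts i).realize v

/-- Truth of a formula under an assignment. -/
def Formula.Realize : {α : Type} → {σ : α → S} → Formula L α σ → ((a : α) → M (σ a)) → Prop
  | _, _, .falsum, _ => False
  | _, _, .equal t₁ t₂, v => t₁.realize v = t₂.realize v
  | _, _, .rel R ts, v => Structure.RelMap R fun i => (ts i).realize v
  | _, _, .imp φ ψ, v => φ.Realize v → ψ.Realize v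
  | _, _, .all s φ, v => ∀ x : M s, φ.Realize (extendVal x v)

end Semantics

section Notions

variable {S : Type u} (L : MSLanguage.{u, v} S) (M : S → Type w) [L.Structure M]

variable {M} in
/-- `X ⊆ M s` is definable with parameters from `A`, a set of elements of `M` of any sorts. -/
def DefinableOver (A : Set (Σ s, M s)) {s : S} (X : Set (M s)) : Prop :=
  ∃ (m : ℕ) (τ : Fin m → S) (p : (i : Fin m) → M (τ i)),
    (∀ i, (⟨τ i, p i⟩ : Σ s, M s) ∈ A) ∧
      ∃ φ : Formula L (Option (Fin m)) (extend τ s), X = {x | φ.Realize (extendVal x p)}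

variable {M} in
/-- The algebraic closure of `A`: the union of the finite `A`-definable sets, over all sorts. -/
def acl (A : Set (Σ s, M s)) : Set (Σ s, M s) :=
  {x | ∃ X : Set (M x.1), DefinableOver L A X ∧ X.Finite ∧ x.2 ∈ X}

/-- Saturation of a countable structure: a family of subsets of a sort, all definable over one
finite set of parameters, has a common point as soon as it has the finite intersection property.
(The empty subfamily is included: it says that the sort is non-empty.) -/
def IsSaturated : Prop :=
  ∀ E : Set (Σ s, M s), E.Finite → ∀ (s : S) (F : Set (Set (M s))),
    (∀ X ∈ F, DefinableOver L E X) →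
    (∀ T : Set (Set (M s)), T ⊆ F → T.Finite → (⋂₀ T).Nonempty) → (⋂₀ F).Nonempty

/-- The automorphism group: families of permutations of the sorts that preserve all symbols. -/
def Aut : Subgroup ((s : S) → Equiv.Perm (M s)) where
  carrier := {g |
    (∀ (n : ℕ) (σ : Fin n → S) (s : S) (f : L.Fn n σ s) (x : (i : Fin n) → M (σ i)),
      g s (Structure.funMap f x) = Structure.funMap f fun i => g (σ i) (x i)) ∧
    ∀ (n : ℕ) (σ : Fin n → S) (R : L.Rel n σ) (x : (i : Fin n) → M (σ i)),
      (Structure.RelMap R fun i => g (σ i) (x i)) ↔ Structure.RelMap R x}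
  one_mem' := ⟨fun _ _ _ _ _ => rfl, fun _ _ _ _ => Iff.rfl⟩
  mul_mem' := by
    rintro g h ⟨hg1, hg2⟩ ⟨hh1, hh2⟩
    refine ⟨fun n σ s f x => ?_, fun n σ R x => ?_⟩
    · simp only [Pi.mul_apply, Equiv.Perm.mul_apply]
      rw [hh1, hg1]
    · simp only [Pi.mul_apply, Equiv.Perm.mul_apply]
      rw [hg2 n σ R (fun i => h (σ i) (x i)), hh2]
  inv_mem' := by
    rintro g ⟨hg1, hg2⟩
    refine ⟨fun n σ s f x => ?_, fun n σ R x => ?_⟩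
    · simp only [Pi.inv_apply]
      rw [Equiv.Perm.inv_eq_iff_eq, hg1]
      simp
    · rw [← hg2]
      simp

/-- `Aut(M/A)`: the automorphisms fixing every element of `A`. -/
def autFixing (A : Set (Σ s, M s)) : Subgroup (Aut L M) where
  carrier := {g | ∀ x ∈ A, g.1 x.1 x.2 = x.2}
  one_mem' := fun _ _ => rfl
  mul_mem' := by
    intro g h hg hh x hx
    have h1 : h.1 x.1 x.2 = x.2 := hh x hx
    have h2 : g.1 x.1 x.2 = x.2 := hg x hx
    change g.1 x.1 (h.1 x.1 x.2) = x.2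
    rw [h1, h2]
  inv_mem' := by
    intro g hg x hx
    change (g.1 x.1)⁻¹ x.2 = x.2
    rw [Equiv.Perm.inv_eq_iff_eq]
    exact (hg x hx).symm

/-- The imaginary sorts: the `∅`-definable equivalence relations on finite products of sorts. -/
structure EqSort where
  arity : ℕ
  dom : Fin arity → S
  rel : Setoid ((i : Fin arity) → M (dom i))
  definable : ∃ φ : Formula L (Fin arity ⊕ Fin arity) (Sum.elim dom dom),
    ∀ x y, rel x y ↔ φ.Realize (pairVal x y)

/-- The underlying family of sets of `M^eq`: the sorts of `M`, and the quotients of finite products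
of sorts by `∅`-definable equivalence relations. -/
def EqCarrier : S ⊕ EqSort L M → Type w
  | Sum.inl s => M s
  | Sum.inr E => Quotient E.rel

/-- The function symbols of `M^eq`: those of `L` on the sorts of `M`, and the quotient maps. -/
inductive EqFn : (n : ℕ) → (Fin n → S ⊕ EqSort L M) → S ⊕ EqSort L M → Type (max u v w) where
  | home {n : ℕ} {σ : Fin n → S} {s : S} (f : L.Fn n σ s) :
      EqFn n (fun i => Sum.inl (σ i)) (Sum.inl s)
  | proj (E : EqSort L M) : EqFn E.arity (fun i => Sum.inl (E.dom i)) (Sum.inr E)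

/-- The relation symbols of `M^eq`: those of `L`, on the sorts of `M`. -/
inductive EqRel : (n : ℕ) → (Fin n → S ⊕ EqSort L M) → Type (max u v w) where
  | home {n : ℕ} {σ : Fin n → S} (R : L.Rel n σ) : EqRel n (fun i => Sum.inl (σ i))

/-- The language of `M^eq`. -/
def eqLanguage : MSLanguage (S ⊕ EqSort L M) where
  Fn := EqFn L M
  Rel := EqRel L M

/-- The value of a function symbol of `M^eq`. -/
def eqFunMap : {n : ℕ} → {σ : Fin n → S ⊕ EqSort L M} → {s : S ⊕ EqSort L M} →
    EqFn L M n σ s → ((i : Fin n) → EqCarrier L M (σ i)) → EqCarrier L M s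
  | _, _, _, .home f, x => Structure.funMap (M := M) f x
  | _, _, _, .proj E, x => Quotient.mk E.rel x

/-- The value of a relation symbol of `M^eq`. -/
def eqRelMap : {n : ℕ} → {σ : Fin n → S ⊕ EqSort L M} →
    EqRel L M n σ → ((i : Fin n) → EqCarrier L M (σ i)) → Prop
  | _, _, .home R, x => Structure.RelMap (M := M) R x

/-- The many-sorted structure `M^eq`. -/
instance eqStructure : (eqLanguage L M).Structure (EqCarrier L M) where
  funMap f x := eqFunMap L M f x
  RelMap R x := eqRelMap L M R x

variable {L M}

theorem Aut.term_realize (g : Aut L M) {α : Type} {σ : α → S} (v : (a : α) → M (σ a)) {s : S}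
    (t : Term L σ s) : t.realize (fun a => g.1 (σ a) (v a)) = g.1 s (t.realize v) := by
  induction t with
  | var a => rfl
  | func f ts ih =>
    simp only [Term.realize]
    rw [g.2.1]
    congr 1
    funext i
    exact ih i

theorem Aut.formula_realize (g : Aut L M) {α : Type} {σ : α → S} (φ : Formula L α σ)
    (v : (a : α) → M (σ a)) : φ.Realize (fun a => g.1 (σ a) (v a)) ↔ φ.Realize v := by
  induction φ with
  | falsum => rfl
  | equal t₁ t₂ =>
    simp only [Formula.Realize, Aut.term_realize]
    exact (g.1 _).injective.eq_iff
  | rel R ts =>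
    simp only [Formula.Realize, Aut.term_realize]
    exact g.2.2 _ _ R _
  | imp φ ψ ihφ ihψ => simp only [Formula.Realize, ihφ, ihψ]
  | @all α σ s φ ih =>
    simp only [Formula.Realize]
    rw [← (g.1 s).forall_congr_right]
    refine forall_congr' fun x => ?_
    rw [← ih (extendVal x v)]
    refine iff_of_eq (congrArg _ ?_)
    funext a
    cases a <;> rfl

theorem Aut.eqSort_rel (g : Aut L M) (E : EqSort L M) (x y : (i : Fin E.arity) → M (E.dom i)) :
    E.rel x y ↔ E.rel (fun i => g.1 _ (x i)) (fun i => g.1 _ (y i)) := by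
  obtain ⟨φ, hφ⟩ := E.definable
  rw [hφ, hφ, ← Aut.formula_realize g φ]
  refine iff_of_eq (congrArg _ ?_)
  funext a
  cases a <;> rfl

/-- The permutation of each sort of `M^eq` induced by an automorphism of `M`. -/
def Aut.eqPerm (g : Aut L M) : (s : S ⊕ EqSort L M) → Equiv.Perm (EqCarrier L M s)
  | Sum.inl s => g.1 s
  | Sum.inr E => Quotient.congr (ra := E.rel) (rb := E.rel)
      (Equiv.piCongrRight fun i => g.1 (E.dom i)) (Aut.eqSort_rel g E)

variable (L M)

/-- The action of `Aut(M)` on `M^eq`, by automorphisms of `M^eq`. -/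
def autEq : Aut L M →* Aut (eqLanguage L M) (EqCarrier L M) where
  toFun g := ⟨Aut.eqPerm g, by
    refine ⟨fun n σ s f x => ?_, fun n σ R x => ?_⟩
    · cases f with
      | home f => exact g.2.1 _ _ _ f x
      | proj E => rfl
    · cases R with
      | home R => exact g.2.2 _ _ R x⟩
  map_one' := by
    apply Subtype.ext
    funext s
    apply Equiv.ext
    intro e
    cases s with
    | inl s => rfl
    | inr E => induction e using Quotient.inductionOn with | h x => rfl
  map_mul' g h := by
    apply Subtype.ext
    funext s
    apply Equiv.ext
    intro e
    cases s with
    | inl s => rfl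
    | inr E => induction e using Quotient.inductionOn with | h x => rfl

end Notions

end MSLanguage

/-!
# Free groups of automorphisms acting freely outside `acl^eq(∅)`

The automorphisms `f, g` are built by a back-and-forth construction inside the group `G` of strong
automorphisms (`strongAut`), those preserving every `∅`-definable equivalence relation with finitely
many classes; they fix `acl(∅)` pointwise (`strongAut_le_autFixing`). A stage of the construction
records the restrictions of `f, g` to finite sets of elements of `M`. Call an edge `e → f e` of the
action on imaginaries controlled if `e` is algebraic over the finite domain on which `f` is
recorded, and similarly for `g`. The property carried along is that, for all extensions of the
recorded maps to elements of `G`, the graph of controlled edges has no cyclically reduced cycle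
outside `acl^eq(∅)`. In the limit every edge is controlled, and a point fixed by a non-trivial word
would lie, up to conjugation, on such a cycle.

To extend the recorded map `a ↦ b` of `f` to a new element `c`, the image `d` of `c` is chosen among
its conjugates over `b` such that everything algebraic both over `b, d` and over all the elements
recorded so far is algebraic over `b`. The end point of a new controlled edge `e → f e` is then
algebraic over `b, d` and not over `b`, so it is incident to no other controlled edge. No reduced
cycle passes through such a leaf, so the property persists (`IsReducedCycle.of_leaf`,
`FreeCondition.exists_le_of_leaf`). Extending the range of `f` is symmetric. This part only uses the
formal properties of algebraic closure collected in `IsIndependentClosure`, and is carried out in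
`IsIndependentClosure.exists_free`.

The model theory consists in verifying these properties (`isIndependentClosure_imagAcl`). Saturation
and countability make `G` act transitively on the tuples of a given strong type
(`StrongEq.exists_strongAut`), and imply that an imaginary with a finite orbit under the stabilizer
of a tuple is algebraic over it (`algOver_of_finite_orbit`). The existence of `d` is the realization
of a partial type, which is finitely satisfiable because points with infinite orbits can be moved
off finite sets (`exists_strongFixing_algOver`). -/

universe x

/-! ### Definable properties of tuples -/

namespace MSLanguage

section Definability

variable {S : Type u} {L : MSLanguage.{u, v} S} {M : S → Type w}

/-- The first half of an assignment to two disjoint families of variables. -/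
def lft {α β : Type} {σ : α → S} {τ : β → S} (v : (c : α ⊕ β) → M (Sum.elim σ τ c)) :
    (a : α) → M (σ a) := fun a => v (Sum.inl a)

/-- The second half of an assignment to two disjoint families of variables. -/
def rgt {α β : Type} {σ : α → S} {τ : β → S} (v : (c : α ⊕ β) → M (Sum.elim σ τ c)) :
    (b : β) → M (τ b) := fun b => v (Sum.inr b)

theorem pairVal_lft_rgt {α β : Type} {σ : α → S} {τ : β → S}
    (v : (c : α ⊕ β) → M (Sum.elim σ τ c)) : pairVal (lft v) (rgt v) = v := by
  funext c; cases c <;> rfl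

/-- A map between assignment spaces each of whose coordinates is a coordinate of the argument:
a substitution of variables for variables. -/
def IsReindex {α β : Type} {σ : α → S} {τ : β → S}
    (F : ((b : β) → M (τ b)) → (a : α) → M (σ a)) : Prop :=
  ∀ a, ∃ (b : β) (h : τ b = σ a), ∀ v, F v a = h ▸ v b

theorem Term.realize_cast [L.Structure M] {α : Type} {σ : α → S} {s s' : S} (h : s = s')
    (t : Term L σ s) (v : (a : α) → M (σ a)) :
    (h ▸ t : Term L σ s').realize v = h ▸ t.realize v := by
  subst h; rfl

theorem Term.exists_reindex [L.Structure M] {α β : Type} {σ : α → S} {τ : β → S}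
    {F : ((b : β) → M (τ b)) → (a : α) → M (σ a)} (hF : IsReindex F) {s : S} (t : Term L σ s) :
    ∃ t' : Term L τ s, ∀ v, t'.realize v = t.realize (F v) := by
  induction t with
  | var a =>
    obtain ⟨b, h, hb⟩ := hF a
    refine ⟨h ▸ Term.var b, fun v => ?_⟩
    rw [Term.realize_cast]
    exact (hb v).symm
  | func f ts ih =>
    choose ts' h using ih
    refine ⟨Term.func f ts', fun v => ?_⟩
    simp only [Term.realize, h]

theorem IsReindex.extend {α β : Type} {σ : α → S} {τ : β → S}
    {F : ((b : β) → M (τ b)) → (a : α) → M (σ a)} (hF : IsReindex F) (s : S) :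
    IsReindex (σ := extend σ s) (τ := extend τ s)
      (fun v => extendVal (M := M) (v none) (F fun b => v (some b))) := by
  rintro (_ | a)
  · exact ⟨none, rfl, fun v => rfl⟩
  · obtain ⟨b, h, hb⟩ := hF a
    exact ⟨some b, h, fun v => hb _⟩

theorem Formula.exists_reindex [L.Structure M] {α β : Type} {σ : α → S} {τ : β → S}
    {F : ((b : β) → M (τ b)) → (a : α) → M (σ a)} (hF : IsReindex F) (φ : Formula L α σ) :
    ∃ ψ : Formula L β τ, ∀ v, ψ.Realize v ↔ φ.Realize (F v) := by
  induction φ generalizing β with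
  | falsum => exact ⟨.falsum, fun v => Iff.rfl⟩
  | equal t₁ t₂ =>
    obtain ⟨t₁', h₁⟩ := t₁.exists_reindex hF
    obtain ⟨t₂', h₂⟩ := t₂.exists_reindex hF
    exact ⟨.equal t₁' t₂', fun v => by simp only [Formula.Realize, h₁, h₂]⟩
  | rel R ts =>
    choose ts' h using fun i => (ts i).exists_reindex hF
    exact ⟨.rel R ts', fun v => by simp only [Formula.Realize, h]⟩
  | imp φ ψ ihφ ihψ =>
    obtain ⟨φ', h₁⟩ := ihφ hF
    obtain ⟨ψ', h₂⟩ := ihψ hF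
    exact ⟨.imp φ' ψ', fun v => by simp only [Formula.Realize, h₁, h₂]⟩
  | all s φ ih =>
    obtain ⟨φ', h⟩ := ih (hF.extend s)
    exact ⟨.all s φ', fun v => forall_congr' fun x => h _⟩

variable [L.Structure M]

variable (L) in
/-- A property of assignments to sorted variables is `∅`-definable if some `L`-formula expresses
it. A property of several tuples is handled as a property of the assignment to the sum of their
variable sets, by means of `lft` and `rgt`. -/
def IsDef {α : Type} {σ : α → S} (P : ((a : α) → M (σ a)) → Prop) : Prop :=
  ∃ φ : Formula L α σ, ∀ v, P v ↔ φ.Realize v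

namespace IsDef

variable {α β : Type} {σ : α → S} {τ : β → S} {P Q : ((a : α) → M (σ a)) → Prop}

theorem congr (hP : IsDef L P) (h : ∀ v, Q v ↔ P v) : IsDef L Q := by
  obtain ⟨φ, hφ⟩ := hP
  exact ⟨φ, fun v => (h v).trans (hφ v)⟩

theorem false : IsDef L (fun _ : (a : α) → M (σ a) => False) :=
  ⟨.falsum, fun _ => Iff.rfl⟩

theorem imp (hP : IsDef L P) (hQ : IsDef L Q) : IsDef L (fun v => P v → Q v) := by
  obtain ⟨φ, hφ⟩ := hP
  obtain ⟨ψ, hψ⟩ := hQ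
  exact ⟨.imp φ ψ, fun v => by simp only [Formula.Realize, hφ, hψ]⟩

theorem not (hP : IsDef L P) : IsDef L (fun v => ¬ P v) := hP.imp false

theorem true : IsDef L (fun _ : (a : α) → M (σ a) => True) :=
  (false (L := L)).not.congr fun _ => by simp

theorem and (hP : IsDef L P) (hQ : IsDef L Q) : IsDef L (fun v => P v ∧ Q v) :=
  (hP.imp hQ.not).not.congr fun _ => by simp

theorem or (hP : IsDef L P) (hQ : IsDef L Q) : IsDef L (fun v => P v ∨ Q v) :=
  (hP.not.imp hQ).congr fun _ => or_iff_not_imp_left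

theorem iff (hP : IsDef L P) (hQ : IsDef L Q) : IsDef L (fun v => P v ↔ Q v) :=
  ((hP.imp hQ).and (hQ.imp hP)).congr fun _ => iff_iff_implies_and_implies

theorem comap (hP : IsDef L P) {F : ((b : β) → M (τ b)) → (a : α) → M (σ a)}
    (hF : IsReindex F) : IsDef L (fun v => P (F v)) := by
  obtain ⟨φ, hφ⟩ := hP
  obtain ⟨ψ, hψ⟩ := φ.exists_reindex hF
  exact ⟨ψ, fun v => (hφ _).trans (hψ v).symm⟩

theorem all {s : S} {P : M s → ((a : α) → M (σ a)) → Prop}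
    (hP : IsDef L (fun v : (c : Option α) → M (extend σ s c) => P (v none) fun a => v (some a))) :
    IsDef L (fun v => ∀ x, P x v) := by
  obtain ⟨φ, hφ⟩ := hP
  exact ⟨.all s φ, fun v => forall_congr' fun x => hφ (extendVal x v)⟩

theorem ex {s : S} {P : M s → ((a : α) → M (σ a)) → Prop}
    (hP : IsDef L (fun v : (c : Option α) → M (extend σ s c) => P (v none) fun a => v (some a))) :
    IsDef L (fun v => ∃ x, P x v) :=
  (all (P := fun x v => ¬ P x v) hP.not).not.congr fun _ => by simp

theorem forall_finset {ι : Type*} (T : Finset ι) {P : ι → ((a : α) → M (σ a)) → Prop}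
    (hP : ∀ i, IsDef L (P i)) : IsDef L (fun v => ∀ i ∈ T, P i v) := by
  classical
  induction T using Finset.induction_on with
  | empty => exact true.congr fun _ => by simp
  | insert i T _ ih => exact ((hP i).and ih).congr fun _ => by simp

theorem forall_finite {ι : Type*} [Finite ι] {P : ι → ((a : α) → M (σ a)) → Prop}
    (hP : ∀ i, IsDef L (P i)) : IsDef L (fun v => ∀ i, P i v) := by
  have := Fintype.ofFinite ι
  exact (forall_finset Finset.univ hP).congr fun _ => by simp

theorem exists_finite {ι : Type*} [Finite ι] {P : ι → ((a : α) → M (σ a)) → Prop}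
    (hP : ∀ i, IsDef L (P i)) : IsDef L (fun v => ∃ i, P i v) :=
  (forall_finite fun i => (hP i).not).not.congr fun _ => by simp

end IsDef

/-- Assemble an assignment to the variables `Option α` from its value at `none` and the rest. -/
def consVal {α : Type} {σ : Option α → S} (x : M (σ none)) (v : (a : α) → M (σ (some a))) :
    (c : Option α) → M (σ c)
  | none => x
  | some a => v a

theorem consVal_none_some {α : Type} {σ : Option α → S} (v : (c : Option α) → M (σ c)) :
    consVal (v none) (fun a => v (some a)) = v := by
  funext c; cases c <;> rfl

theorem isReindex_piCongrLeft {α α' : Type} (e : α ≃ α') (σ : α' → S) :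
    IsReindex (Equiv.piCongrLeft (fun a => M (σ a)) e) := by
  have key : ∀ {a b : α'} (h₁ : b = a) (h₂ : σ b = σ a) (y : M (σ b)),
      (h₁ ▸ y : M (σ a)) = h₂ ▸ y := by
    rintro a _ rfl _ y
    rfl
  intro a
  refine ⟨e.symm a, congrArg σ (e.apply_symm_apply a), fun v => ?_⟩
  rw [Equiv.piCongrLeft_apply]
  exact key (e.apply_symm_apply a) _ _

/-- Substitution of variables in the first of two tuples. -/
theorem IsReindex.sum_left {α α' β : Type} {σ : α → S} {σ' : α' → S} {τ : β → S}
    {F : ((b : α') → M (σ' b)) → (a : α) → M (σ a)} (hF : IsReindex F) :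
    IsReindex (σ := Sum.elim σ τ) (τ := Sum.elim σ' τ)
      (fun v => pairVal (M := M) (F (lft v)) (rgt v)) := by
  rintro (a | b)
  · obtain ⟨a', h, ha⟩ := hF a
    exact ⟨Sum.inl a', h, fun v => ha _⟩
  · exact ⟨Sum.inr b, rfl, fun v => rfl⟩

/-- Substitution of variables in the second of two tuples. -/
theorem IsReindex.sum_right {α β β' : Type} {σ : α → S} {τ : β → S} {τ' : β' → S}
    {F : ((b : β') → M (τ' b)) → (a : β) → M (τ a)} (hF : IsReindex F) :
    IsReindex (σ := Sum.elim σ τ) (τ := Sum.elim σ τ')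
      (fun v => pairVal (M := M) (lft v) (F (rgt v))) := by
  rintro (a | b)
  · exact ⟨Sum.inl a, rfl, fun v => rfl⟩
  · obtain ⟨a', h, ha⟩ := hF b
    exact ⟨Sum.inr a', h, fun v => ha _⟩

/-- Definable properties are closed under quantification over finite tuples. -/
theorem IsDef.forall_tuple {α : Type} [Finite α] {σ : α → S} :
    ∀ {β : Type} {τ : β → S} {P : ((a : α) → M (σ a)) → ((b : β) → M (τ b)) → Prop},
      IsDef L (fun v : (c : α ⊕ β) → M (Sum.elim σ τ c) => P (lft v) (rgt v)) →
        IsDef L (fun y => ∀ x, P x y) := by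
  induction α using Finite.induction_empty_option with
  | of_equiv e ih =>
    intro β τ P hP
    refine (ih (σ := fun a => σ (e a))
      (P := fun x y => P (Equiv.piCongrLeft (fun a => M (σ a)) e x) y)
      (hP.comap (isReindex_piCongrLeft e σ).sum_left)).congr fun y => ?_
    exact ((Equiv.piCongrLeft (fun a => M (σ a)) e).forall_congr_right (q := fun x => P x y)).symm
  | h_empty =>
    intro β τ P hP
    refine (hP.comap (F := fun y => pairVal (fun a => a.elim) y) ?_).congr fun y => ?_
    · rintro (a | b)
      · exact a.elim
      · exact ⟨b, rfl, fun _ => rfl⟩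
    · refine ⟨fun h => h _, fun h x => ?_⟩
      have hx : x = fun a => a.elim := funext fun a => a.elim
      subst hx
      exact h
  | @h_option γ _ ih =>
    intro β τ P hP
    refine (IsDef.all (s := σ none) (P := fun x0 y => ∀ x', P (consVal x0 x') y)
      (ih (σ := fun a => σ (some a)) (τ := extend τ (σ none))
        (P := fun x' y' => P (consVal (y' none) x') (fun b => y' (some b)))
        (hP.comap (F := fun (v : (c : γ ⊕ Option β) →
            M (Sum.elim (fun a => σ (some a)) (extend τ (σ none)) c)) =>
          pairVal (consVal (rgt v none) (lft v))
          (fun b => rgt v (some b))) ?_))).congr fun y => ?_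
    · rintro ((_ | a) | b)
      · exact ⟨Sum.inr none, rfl, fun _ => rfl⟩
      · exact ⟨Sum.inl a, rfl, fun _ => rfl⟩
      · exact ⟨Sum.inr (some b), rfl, fun _ => rfl⟩
    · refine ⟨fun h x0 x' => h _, fun h x => ?_⟩
      rw [← consVal_none_some x]
      exact h _ _

theorem IsDef.exists_tuple {α β : Type} [Finite α] {σ : α → S} {τ : β → S}
    {P : ((a : α) → M (σ a)) → ((b : β) → M (τ b)) → Prop}
    (hP : IsDef L (fun v : (c : α ⊕ β) → M (Sum.elim σ τ c) => P (lft v) (rgt v))) :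
    IsDef L (fun y => ∃ x, P x y) :=
  (IsDef.forall_tuple (P := fun x y => ¬ P x y) hP.not).not.congr fun _ => by simp

/-- Equality of two variables of the same sort is definable. -/
theorem IsDef.var_eq {α : Type} {σ : α → S} (a b : α) (h : σ b = σ a) :
    IsDef L (fun v : (a : α) → M (σ a) => v a = h ▸ v b) :=
  ⟨.equal (.var a) (h ▸ .var b), fun v => by
    simp only [Formula.Realize, Term.realize_cast, Term.realize]⟩

theorem IsDef.realize {α : Type} {σ : α → S} (φ : Formula L α σ) :
    IsDef L (fun v : (a : α) → M (σ a) => φ.Realize v) := ⟨φ, fun _ => Iff.rfl⟩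

/-- Automorphisms preserve definable properties. -/
theorem IsDef.aut {α : Type} {σ : α → S} {P : ((a : α) → M (σ a)) → Prop} (hP : IsDef L P)
    (g : Aut L M) (v : (a : α) → M (σ a)) : P (fun a => g.1 (σ a) (v a)) ↔ P v := by
  obtain ⟨φ, hφ⟩ := hP
  rw [hφ, hφ, Aut.formula_realize]

end Definability
end MSLanguage

/-! ### Saturation and strong types -/

namespace MSLanguage

section Saturation

variable {S : Type u} {L : MSLanguage.{u, v} S} {M : S → Type w} [L.Structure M]

/-- Saturation for one variable, in terms of definable properties with a finite tuple `q` of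
parameters. -/
theorem IsSaturated.exists_forall_one (hsat : IsSaturated L M) {β : Type} [Finite β] {τ : β → S}
    (q : (b : β) → M (τ b)) {s : S} {I : Type x} {P : I → M s → ((b : β) → M (τ b)) → Prop}
    (hdef : ∀ i, IsDef L (fun v : (c : Option β) → M (extend τ s c) =>
      P i (v none) fun b => v (some b)))
    (fip : ∀ T : Finset I, ∃ y, ∀ i ∈ T, P i y q) : ∃ y, ∀ i, P i y q := by
  classical
  obtain ⟨n, ⟨e⟩⟩ := Finite.exists_equiv_fin β
  have hq : Equiv.piCongrLeft (fun b => M (τ b)) e.symm (fun a => q (e.symm a)) = q := by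
    funext b
    obtain ⟨a, rfl⟩ := e.symm.surjective b
    rw [Equiv.piCongrLeft_apply_apply]
  suffices h : (⋂₀ Set.range fun i => {y | P i y q}).Nonempty by
    obtain ⟨y, hy⟩ := h
    exact ⟨y, fun i => hy _ ⟨i, rfl⟩⟩
  refine hsat (Set.range fun b => (⟨τ b, q b⟩ : Σ s, M s)) (Set.finite_range _) s _ ?_ ?_
  · rintro _ ⟨i, rfl⟩
    obtain ⟨φ, hφ⟩ := (hdef i).comap ((isReindex_piCongrLeft (M := M) e.symm τ).extend s)
    refine ⟨n, fun a => τ (e.symm a), fun a => q (e.symm a), fun a => ⟨e.symm a, rfl⟩, φ, ?_⟩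
    ext y
    have := hφ (extendVal y fun a => q (e.symm a))
    refine Iff.trans ?_ this
    change P i y q ↔ P i y (Equiv.piCongrLeft (fun b => M (τ b)) e.symm (fun a => q (e.symm a)))
    rw [hq]
  · intro T hT hfin
    choose j hj using hT
    have := hfin.fintype
    obtain ⟨y, hy⟩ := fip (Finset.univ.image fun X : T => j X.2)
    refine ⟨y, fun X hX => ?_⟩
    have h1 : P (j hX) y q := hy _ (Finset.mem_image.2 ⟨⟨X, hX⟩, Finset.mem_univ _, rfl⟩)
    have h2 := hj hX
    simp only at h2
    rw [← h2]
    exact h1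

/-- Saturation for a finite tuple of variables. -/
theorem IsSaturated.exists_forall (hsat : IsSaturated L M) {α : Type} [Finite α] {σ : α → S} :
    ∀ {β : Type} [Finite β] {τ : β → S} (q : (b : β) → M (τ b)) {I : Type x}
      {P : I → ((a : α) → M (σ a)) → ((b : β) → M (τ b)) → Prop},
      (∀ i, IsDef L (fun v : (c : α ⊕ β) → M (Sum.elim σ τ c) => P i (lft v) (rgt v))) →
      (∀ T : Finset I, ∃ y, ∀ i ∈ T, P i y q) → ∃ y, ∀ i, P i y q := by
  classical
  induction α using Finite.induction_empty_option with
  | of_equiv e ih =>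
    intro β _ τ q I P hdef fip
    obtain ⟨y, hy⟩ := ih (σ := fun a => σ (e a)) q
      (P := fun i y => P i (Equiv.piCongrLeft (fun a => M (σ a)) e y))
      (fun i => (hdef i).comap (isReindex_piCongrLeft e σ).sum_left) fun T => by
        obtain ⟨y, hy⟩ := fip T
        refine ⟨(Equiv.piCongrLeft (fun a => M (σ a)) e).symm y, ?_⟩
        simpa using hy
    exact ⟨_, hy⟩
  | h_empty =>
    intro β _ τ q I P hdef fip
    refine ⟨fun a => a.elim, fun i => ?_⟩
    obtain ⟨y, hy⟩ := fip {i}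
    have hy' : y = fun a => a.elim := funext fun a => a.elim
    subst hy'
    exact hy i (Finset.mem_singleton_self i)
  | @h_option γ _ ih =>
    intro β _ τ q I P hdef fip
    have hdef' : ∀ i, IsDef L (fun v : (c : γ ⊕ Option β) →
        M (Sum.elim (fun a => σ (some a)) (extend τ (σ none)) c) =>
        P i (consVal (rgt v none) (lft v)) (fun b => rgt v (some b))) := by
      intro i
      refine (hdef i).comap (F := fun (v : (c : γ ⊕ Option β) →
        M (Sum.elim (fun a => σ (some a)) (extend τ (σ none)) c)) =>
          pairVal (consVal (rgt v none) (lft v)) (fun b => rgt v (some b))) ?_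
      rintro ((_ | a) | b)
      · exact ⟨Sum.inr none, rfl, fun _ => rfl⟩
      · exact ⟨Sum.inl a, rfl, fun _ => rfl⟩
      · exact ⟨Sum.inr (some b), rfl, fun _ => rfl⟩
    obtain ⟨x0, hx0⟩ := hsat.exists_forall_one q (s := σ none) (I := Finset I)
      (P := fun T x0 y => ∃ x', ∀ i ∈ T, P i (consVal x0 x') y)
      (fun T => IsDef.exists_tuple (σ := fun a => σ (some a)) (τ := extend τ (σ none))
        (P := fun x' y' => ∀ i ∈ T, P i (consVal (y' none) x') (fun b => y' (some b)))
        (IsDef.forall_finset T hdef')) fun T => by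
          obtain ⟨y, hy⟩ := fip (T.sup id)
          refine ⟨y none, fun T' hT' => ⟨fun a => y (some a), fun i hi => ?_⟩⟩
          rw [consVal_none_some]
          exact hy i ((Finset.le_sup (f := id) hT' : T' ≤ _) hi)
    obtain ⟨x', hx'⟩ := ih (σ := fun a => σ (some a)) (τ := extend τ (σ none)) (extendVal x0 q)
      (P := fun i x' y' => P i (consVal (y' none) x') (fun b => y' (some b))) hdef' hx0
    exact ⟨consVal x0 x', hx'⟩

end Saturation

section StrongTypes

variable {S : Type u} {L : MSLanguage.{u, v} S} {M : S → Type w} [L.Structure M]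
variable {α β : Type} {σ : α → S} {τ : β → S}

variable (L) in
/-- A finite equivalence relation: an `∅`-definable equivalence relation with finitely many
classes, on tuples with given sorts. -/
structure IsFER (r : Setoid ((a : α) → M (σ a))) : Prop where
  finite : Finite (Quotient r)
  isDef : IsDef L (fun v : (c : α ⊕ α) → M (Sum.elim σ σ c) => r (lft v) (rgt v))

theorem IsFER.ker {Q : Type*} [Finite Q] (f : ((a : α) → M (σ a)) → Q)
    (hf : IsDef L (fun v : (c : α ⊕ α) → M (Sum.elim σ σ c) => f (lft v) = f (rgt v))) :
    IsFER L (Setoid.ker f) :=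
  ⟨Finite.of_injective _ (Setoid.kerLift_injective f), hf.congr fun _ => Setoid.ker_def⟩

theorem IsFER.inf {r r' : Setoid ((a : α) → M (σ a))} (h : IsFER L r) (h' : IsFER L r') :
    IsFER L (r ⊓ r') := by
  have := h.finite
  have := h'.finite
  refine ⟨?_, (h.isDef.and h'.isDef).congr fun v => Iff.rfl⟩
  refine Finite.of_injective (β := Quotient r × Quotient r')
    (Quotient.lift (fun v => (Quotient.mk r v, Quotient.mk r' v)) ?_) ?_
  · intro a b hab
    exact Prod.ext (Quotient.sound hab.1) (Quotient.sound hab.2)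
  · intro a b
    induction a using Quotient.inductionOn with | h a =>
    induction b using Quotient.inductionOn with | h b =>
    intro hab
    have := Prod.ext_iff.1 hab
    exact Quotient.sound ⟨Quotient.exact this.1, Quotient.exact this.2⟩

theorem IsFER.exists_le_finset (T : Finset {r : Setoid ((a : α) → M (σ a)) // IsFER L r}) :
    ∃ R, IsFER L R ∧ ∀ r ∈ T, R ≤ r.1 := by
  classical
  induction T using Finset.induction_on with
  | empty =>
    refine ⟨_, IsFER.ker (L := L) (fun _ => ()) (IsDef.true.congr fun _ => by simp), by simp⟩
  | insert r T _ ih =>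
    obtain ⟨R, hR, h⟩ := ih
    refine ⟨R ⊓ r.1, hR.inf r.2, ?_⟩
    simp only [Finset.mem_insert, forall_eq_or_imp]
    exact ⟨inf_le_right, fun r' hr' => inf_le_left.trans (h r' hr')⟩

variable (L) in
/-- Two tuples have the same strong type over `∅` if every finite equivalence relation
identifies them. -/
def StrongEq (x y : (a : α) → M (σ a)) : Prop := ∀ r, IsFER L r → r x y

namespace StrongEq

variable {x y z : (a : α) → M (σ a)}

theorem refl (x : (a : α) → M (σ a)) : StrongEq L x x := fun r _ => r.refl x

theorem symm (h : StrongEq L x y) : StrongEq L y x := fun r hr => r.symm (h r hr)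

theorem trans (h : StrongEq L x y) (h' : StrongEq L y z) : StrongEq L x z :=
  fun r hr => r.trans (h r hr) (h' r hr)

theorem eq_of_ker (h : StrongEq L x y) {Q : Type*} [Finite Q] (f : ((a : α) → M (σ a)) → Q)
    (hf : IsDef L (fun v : (c : α ⊕ α) → M (Sum.elim σ σ c) => f (lft v) = f (rgt v))) :
    f x = f y := Setoid.ker_def.1 (h _ (IsFER.ker f hf))

end StrongEq

theorem isReindex_lft : IsReindex (σ := σ) (τ := Sum.elim σ τ) (lft (M := M)) :=
  fun a => ⟨Sum.inl a, rfl, fun _ => rfl⟩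

theorem isReindex_rgt : IsReindex (σ := τ) (τ := Sum.elim σ τ) (rgt (M := M)) :=
  fun a => ⟨Sum.inr a, rfl, fun _ => rfl⟩

/-- Substitution of variables in both of two tuples. -/
theorem IsReindex.sum {α' β' : Type} {σ' : α' → S} {τ' : β' → S}
    {F : ((b : α') → M (σ' b)) → (a : α) → M (σ a)} (hF : IsReindex F)
    {G : ((b : β') → M (τ' b)) → (b : β) → M (τ b)} (hG : IsReindex G) :
    IsReindex (σ := Sum.elim σ τ) (τ := Sum.elim σ' τ')
      (fun v => pairVal (M := M) (F (lft v)) (G (rgt v))) := by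
  rintro (a | b)
  · obtain ⟨a', h, ha⟩ := hF a
    exact ⟨Sum.inl a', h, fun v => ha _⟩
  · obtain ⟨a', h, ha⟩ := hG b
    exact ⟨Sum.inr a', h, fun v => ha _⟩

namespace StrongEq

variable {x y z : (a : α) → M (σ a)}

theorem iff (h : StrongEq L x y) {P : ((a : α) → M (σ a)) → Prop} (hP : IsDef L P) :
    P x ↔ P y :=
  iff_of_eq (h.eq_of_ker P
    (((hP.comap isReindex_lft).iff (hP.comap isReindex_rgt)).congr fun _ => eq_iff_iff))

theorem comap (h : StrongEq L x y) {F : ((a : α) → M (σ a)) → (b : β) → M (τ b)}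
    (hF : IsReindex F) : StrongEq L (F x) (F y) := by
  intro r hr
  have := hr.finite
  exact Quotient.exact (h.eq_of_ker (fun v => Quotient.mk r (F v))
    ((hr.isDef.comap (hF.sum hF)).congr fun v => Quotient.eq))

/-- Tuples obtained from tuples of the same strong type by the same choice of coordinates have
the same strong type. -/
theorem of_subtuple (h : StrongEq L x y) {x' y' : (b : β) → M (τ b)}
    (hsub : ∀ b, ∃ a, (⟨τ b, x' b, y' b⟩ : Σ s, M s × M s) = ⟨σ a, x a, y a⟩) :
    StrongEq L x' y' := by
  choose ρ hρ using hsub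
  have hs : ∀ b, σ (ρ b) = τ b := fun b => (congrArg Sigma.fst (hρ b)).symm
  have key : ∀ {s s' : S} (h : s' = s) {a b : M s} {a' b' : M s'},
      (⟨s, a, b⟩ : Σ s, M s × M s) = ⟨s', a', b'⟩ → h ▸ a' = a ∧ h ▸ b' = b := by
    rintro s _ rfl a b a' b' heq
    simp only [Sigma.mk.injEq, heq_eq_eq, Prod.mk.injEq, true_and] at heq
    exact ⟨heq.1.symm, heq.2.symm⟩
  have := h.comap (F := fun v b => hs b ▸ v (ρ b)) fun b => ⟨ρ b, hs b, fun _ => rfl⟩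
  rwa [show (fun b => hs b ▸ x (ρ b)) = x' from funext fun b => (key (hs b) (hρ b)).1,
    show (fun b => hs b ▸ y (ρ b)) = y' from funext fun b => (key (hs b) (hρ b)).2] at this

/-- One step of the back-and-forth argument for strong types. For a finite equivalence relation `R`
on the extended tuples, having one-variable extensions in the same `R`-classes is again a finite
equivalence relation. -/
theorem exists_extend [Finite α] (hsat : IsSaturated L M) (h : StrongEq L x y) {s : S} (b : M s) :
    ∃ c, StrongEq L (extendVal b x) (extendVal c y) := by
  classical
  suffices hc : ∃ c, ∀ r : {r : Setoid ((a : Option α) → M (extend σ s a)) // IsFER L r},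
      r.1 (extendVal b x) (extendVal c y) by
    obtain ⟨c, hc⟩ := hc
    exact ⟨c, fun r hr => hc ⟨r, hr⟩⟩
  refine hsat.exists_forall_one (s := s) (pairVal (σ := extend σ s) (extendVal b x) y)
    (I := {r : Setoid ((a : Option α) → M (extend σ s a)) // IsFER L r})
    (P := fun r c q => r.1 (lft q) (extendVal c (rgt q))) ?_ ?_
  · intro r
    refine r.2.isDef.comap (F := fun v : (c : Option (Option α ⊕ α)) →
      M (extend (Sum.elim (extend σ s) σ) s c) =>
        pairVal (fun a => v (some (Sum.inl a)))
          (extendVal (v none) (fun a => v (some (Sum.inr a))))) ?_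
    rintro (a | (_ | a))
    · exact ⟨some (Sum.inl a), rfl, fun _ => rfl⟩
    · exact ⟨none, rfl, fun _ => rfl⟩
    · exact ⟨some (Sum.inr a), rfl, fun _ => rfl⟩
  · intro T
    obtain ⟨R, hR, hle⟩ := IsFER.exists_le_finset T
    have := hR.finite
    -- the set of `R`-classes met by the one-variable extensions of a tuple
    let f : ((a : α) → M (σ a)) → Set (Quotient R) :=
      fun u => Set.range fun c : M s => Quotient.mk R (extendVal c u)
    have hf : f x = f y := by
      refine h.eq_of_ker f ?_
      have hR' : IsDef L (fun v : (c : Option (Option (α ⊕ α))) →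
          M (extend (extend (Sum.elim σ σ) s) s c) =>
          R (extendVal (v (some none)) (fun a => v (some (some (Sum.inl a)))))
            (extendVal (v none) (fun a => v (some (some (Sum.inr a)))))) := by
        refine hR.isDef.comap (F := fun v : (c : Option (Option (α ⊕ α))) →
          M (extend (extend (Sum.elim σ σ) s) s c) => pairVal
            (extendVal (M := M) (v (some none)) (fun a => v (some (some (Sum.inl a)))))
            (extendVal (M := M) (v none) (fun a => v (some (some (Sum.inr a)))))) ?_
        rintro ((_ | a) | (_ | a))
        · exact ⟨some none, rfl, fun _ => rfl⟩
        · exact ⟨some (some (Sum.inl a)), rfl, fun _ => rfl⟩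
        · exact ⟨none, rfl, fun _ => rfl⟩
        · exact ⟨some (some (Sum.inr a)), rfl, fun _ => rfl⟩
      have hR'' : IsDef L (fun v : (c : Option (Option (α ⊕ α))) →
          M (extend (extend (Sum.elim σ σ) s) s c) =>
          R (extendVal (v none) (fun a => v (some (some (Sum.inl a)))))
            (extendVal (v (some none)) (fun a => v (some (some (Sum.inr a)))))) := by
        refine hR.isDef.comap (F := fun v : (c : Option (Option (α ⊕ α))) →
          M (extend (extend (Sum.elim σ σ) s) s c) => pairVal
            (extendVal (M := M) (v none) (fun a => v (some (some (Sum.inl a)))))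
            (extendVal (M := M) (v (some none)) (fun a => v (some (some (Sum.inr a)))))) ?_
        rintro ((_ | a) | (_ | a))
        · exact ⟨none, rfl, fun _ => rfl⟩
        · exact ⟨some (some (Sum.inl a)), rfl, fun _ => rfl⟩
        · exact ⟨some none, rfl, fun _ => rfl⟩
        · exact ⟨some (some (Sum.inr a)), rfl, fun _ => rfl⟩
      refine ((IsDef.all (s := s) (P := fun c v => ∃ d : M s,
          R (extendVal c (lft v)) (extendVal d (rgt v))) (IsDef.ex (s := s)
          (P := fun (d : M s) (v' : (c : Option (α ⊕ α)) → M (extend (Sum.elim σ σ) s c)) =>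
            R (extendVal (v' none) (fun a => v' (some (Sum.inl a))))
            (extendVal d (fun a => v' (some (Sum.inr a))))) hR')).and
        (IsDef.all (s := s) (P := fun c v => ∃ d : M s,
          R (extendVal d (lft v)) (extendVal c (rgt v))) (IsDef.ex (s := s)
          (P := fun (d : M s) (v' : (c : Option (α ⊕ α)) → M (extend (Sum.elim σ σ) s c)) =>
            R (extendVal d (fun a => v' (some (Sum.inl a))))
            (extendVal (v' none) (fun a => v' (some (Sum.inr a))))) hR''))).congr fun v => ?_
      rw [Set.Subset.antisymm_iff, Set.range_subset_iff, Set.range_subset_iff]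
      refine and_congr (forall_congr' fun c => exists_congr fun d => ?_)
        (forall_congr' fun c => exists_congr fun d => ?_)
      · rw [eq_comm]; exact Quotient.eq
      · exact Quotient.eq
    obtain ⟨c, hc⟩ := hf.subset ⟨b, rfl⟩
    exact ⟨c, fun r hr => hle r hr (R.symm (Quotient.exact hc))⟩

end StrongEq

end StrongTypes
end MSLanguage

/-! ### Homogeneity -/

namespace MSLanguage

section Homogeneity

variable {S : Type u} {L : MSLanguage.{u, v} S} {M : S → Type w} [L.Structure M]

variable (L M) in
/-- The group of strong automorphisms: those preserving the strong type of every finite tuple.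
(It is the group of automorphisms acting trivially on `acl^eq(∅)`.) -/
def strongAut : Subgroup (Aut L M) where
  carrier := {g | ∀ (α : Type) [Finite α] (σ : α → S) (x : (a : α) → M (σ a)),
    StrongEq L x (fun a => g.1 (σ a) (x a))}
  one_mem' := fun _ _ _ x => StrongEq.refl x
  mul_mem' := fun {g h} hg hh α _ σ x => (hh α σ x).trans (hg α σ fun a => h.1 (σ a) (x a))
  inv_mem' := fun {g} hg α _ σ x => by
    have h := hg α σ fun a => (g⁻¹).1 (σ a) (x a)
    have h' : (fun a => g.1 (σ a) ((g⁻¹).1 (σ a) (x a))) = x :=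
      funext fun a => (g.1 (σ a)).apply_symm_apply (x a)
    rw [h'] at h
    exact h.symm

variable (L) in
/-- A set of pairs of elements of the same sort preserves strong types if any two finite tuples
that it matches coordinatewise have the same strong type. -/
def PreservesStrong (Γ : Set (Σ s, M s × M s)) : Prop :=
  ∀ (α : Type) [Finite α] (σ : α → S) (x y : (a : α) → M (σ a)),
    (∀ a, (⟨σ a, x a, y a⟩ : Σ s, M s × M s) ∈ Γ) → StrongEq L x y

/-- A total and surjective correspondence that preserves strong types is the graph of a strong
automorphism. -/
theorem PreservesStrong.exists_strongAut {Γ : Set (Σ s, M s × M s)} (hΓ : PreservesStrong L Γ)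
    (htot : ∀ s x, ∃ y, (⟨s, x, y⟩ : Σ s, M s × M s) ∈ Γ)
    (hsurj : ∀ s y, ∃ x, (⟨s, x, y⟩ : Σ s, M s × M s) ∈ Γ) :
    ∃ g ∈ strongAut L M, ∀ s x y, (⟨s, x, y⟩ : Σ s, M s × M s) ∈ Γ → g.1 s x = y := by
  have hiff : ∀ {s : S} {x y x' y' : M s}, (⟨s, x, y⟩ : Σ s, M s × M s) ∈ Γ →
      (⟨s, x', y'⟩ : Σ s, M s × M s) ∈ Γ → (x = x' ↔ y = y') := by
    intro s x y x' y' h h'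
    refine (hΓ Bool (fun _ => s) (fun b => bif b then x' else x) (fun b => bif b then y' else y)
      ?_).iff (IsDef.var_eq false true rfl)
    rintro (_ | _)
    · exact h
    · exact h'
  choose f hf using htot
  choose f' hf' using hsurj
  let e : (s : S) → Equiv.Perm (M s) := fun s =>
    ⟨f s, f' s, fun x => (hiff (hf' s (f s x)) (hf s x)).2 rfl,
      fun y => (hiff (hf s (f' s y)) (hf' s y)).1 rfl⟩
  have he : ∀ s x, (⟨s, x, e s x⟩ : Σ s, M s × M s) ∈ Γ := hf
  have haut : e ∈ Aut L M := by
    refine ⟨fun n σ s F x => ?_, fun n σ R x => ?_⟩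
    · have h := hΓ (Option (Fin n)) (extend σ s) (extendVal (Structure.funMap F x) x)
        (extendVal (e s (Structure.funMap F x)) fun i => e (σ i) (x i)) (by
          rintro (_ | a)
          · exact he _ _
          · exact he _ _)
      let φ : Formula L (Option (Fin n)) (extend σ s) :=
        .equal (s := s) (.var none) (.func F fun i => .var (some i))
      exact (h.iff (IsDef.realize φ)).1 rfl
    · have h := hΓ (Fin n) σ x (fun i => e (σ i) (x i)) fun i => he _ _
      exact (h.iff (IsDef.realize (L := L) (.rel R fun i => .var i))).symm
  refine ⟨⟨e, haut⟩, fun α _ σ x => hΓ α σ x _ fun a => he _ _, fun s x y hxy => ?_⟩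
  exact (hiff (he s x) hxy).1 rfl

variable (L M) in
/-- A finite partial map that preserves strong types, given as a set of pairs. -/
structure PartialStrong where
  graph : Set (Σ s, M s × M s)
  exists_tuple : ∃ (α : Type) (_ : Finite α) (σ : α → S) (x y : (a : α) → M (σ a)),
    StrongEq L x y ∧ graph = Set.range fun a => (⟨σ a, x a, y a⟩ : Σ s, M s × M s)

instance : Preorder (PartialStrong L M) := Preorder.lift PartialStrong.graph

theorem PartialStrong.preserves (p : PartialStrong L M) : PreservesStrong L p.graph := by
  intro α _ σ x y h
  obtain ⟨γ, _, τ, x', y', hxy, hp⟩ := p.exists_tuple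
  rw [hp] at h
  exact hxy.of_subtuple fun a => by
    obtain ⟨c, hc⟩ := h a
    exact ⟨c, hc.symm⟩

theorem PartialStrong.exists_dom (hsat : IsSaturated L M) (p : PartialStrong L M) {s : S}
    (b : M s) :
    ∃ q : PartialStrong L M, p ≤ q ∧ ∃ c, (⟨s, b, c⟩ : Σ s, M s × M s) ∈ q.graph := by
  obtain ⟨γ, _, τ, x, y, hxy, hp⟩ := p.exists_tuple
  obtain ⟨c, hc⟩ := hxy.exists_extend hsat b
  refine ⟨⟨_, Option γ, inferInstance, extend τ s, extendVal b x, extendVal c y, hc, rfl⟩, ?_,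
    c, none, rfl⟩
  change p.graph ⊆ _
  rw [hp]
  rintro _ ⟨a, rfl⟩
  exact ⟨some a, rfl⟩

theorem PartialStrong.exists_ran (hsat : IsSaturated L M) (p : PartialStrong L M) {s : S}
    (c : M s) :
    ∃ q : PartialStrong L M, p ≤ q ∧ ∃ b, (⟨s, b, c⟩ : Σ s, M s × M s) ∈ q.graph := by
  obtain ⟨γ, _, τ, x, y, hxy, hp⟩ := p.exists_tuple
  obtain ⟨b, hb⟩ := hxy.symm.exists_extend hsat c
  refine ⟨⟨_, Option γ, inferInstance, extend τ s, extendVal b x, extendVal c y, hb.symm, rfl⟩, ?_,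
    b, none, rfl⟩
  change p.graph ⊆ _
  rw [hp]
  rintro _ ⟨a, rfl⟩
  exact ⟨some a, rfl⟩

/-- Homogeneity: in a countable saturated structure, two finite tuples with the same strong type
are conjugate under a strong automorphism. -/
theorem StrongEq.exists_strongAut (hcount : Countable (Σ s, M s)) (hsat : IsSaturated L M)
    {α : Type} [Finite α] {σ : α → S} {x y : (a : α) → M (σ a)} (h : StrongEq L x y) :
    ∃ g ∈ strongAut L M, ∀ a, g.1 (σ a) (x a) = y a := by
  have := Encodable.ofCountable (Σ s, M s)
  let p₀ : PartialStrong L M := ⟨_, α, inferInstance, σ, x, y, h, rfl⟩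
  let D : (Σ s, M s) ⊕ (Σ s, M s) → Order.Cofinal (PartialStrong L M)
    | .inl b => ⟨{q | ∃ c, (⟨b.1, b.2, c⟩ : Σ s, M s × M s) ∈ q.graph}, fun p => by
        obtain ⟨q, hpq, hq⟩ := p.exists_dom hsat b.2
        exact ⟨q, hq, hpq⟩⟩
    | .inr c => ⟨{q | ∃ b, (⟨c.1, b, c.2⟩ : Σ s, M s × M s) ∈ q.graph}, fun p => by
        obtain ⟨q, hpq, hq⟩ := p.exists_ran hsat c.2
        exact ⟨q, hq, hpq⟩⟩
  let p := Order.sequenceOfCofinals p₀ D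
  have hmono : Monotone p := Order.sequenceOfCofinals.monotone p₀ D
  have hΓ : PreservesStrong L (⋃ n, (p n).graph) := by
    intro γ _ τ u v huv
    simp only [Set.mem_iUnion] at huv
    choose n hn using huv
    obtain ⟨N, hN⟩ := (Set.finite_range n).bddAbove
    exact (p N).preserves γ τ u v fun a => hmono (hN ⟨a, rfl⟩) (hn a)
  obtain ⟨g, hg, hgΓ⟩ := hΓ.exists_strongAut
    (fun s b => by
      obtain ⟨c, hc⟩ := Order.sequenceOfCofinals.encode_mem p₀ D (.inl ⟨s, b⟩)
      exact ⟨c, Set.mem_iUnion.2 ⟨_, hc⟩⟩)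
    (fun s c => by
      obtain ⟨b, hb⟩ := Order.sequenceOfCofinals.encode_mem p₀ D (.inr ⟨s, c⟩)
      exact ⟨b, Set.mem_iUnion.2 ⟨_, hb⟩⟩)
  exact ⟨g, hg, fun a => hgΓ _ _ _ (Set.mem_iUnion.2 ⟨0, a, rfl⟩)⟩

/-- Strong automorphisms fix the algebraic closure of the empty set: a finite `∅`-definable set `X`
gives the finite equivalence relation whose classes are the points of `X` and the complement of
`X`. -/
theorem strongAut_le_autFixing : strongAut L M ≤ autFixing L M (acl L ∅) := by
  classical
  rintro g hg ⟨s, x⟩ ⟨X, ⟨m, τ, p, hp, φ, hφ⟩, hfin, hx⟩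
  have hm : IsEmpty (Fin m) := ⟨fun i => (hp i).elim⟩
  have hX : IsDef L (fun v : (c : Unit) → M s => v () ∈ X) := by
    refine ((IsDef.realize φ).comap (F := fun v : (c : Unit) → M s => extendVal (v ()) p)
      ?_).congr fun v => by rw [hφ]; rfl
    rintro (_ | i)
    · exact ⟨(), rfl, fun _ => rfl⟩
    · exact (hp i).elim
  have := hfin.to_subtype
  let f : ((c : Unit) → M s) → Option X := fun v => if h : v () ∈ X then some ⟨v (), h⟩ else none
  have hf : IsDef L (fun v : (c : Unit ⊕ Unit) → M (Sum.elim (fun _ => s) (fun _ => s) c) =>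
      f (lft v) = f (rgt v)) := by
    have h1 := hX.comap (isReindex_lft (τ := fun _ : Unit => s))
    have h2 := hX.comap (isReindex_rgt (σ := fun _ : Unit => s))
    refine (((IsDef.var_eq (σ := Sum.elim (fun _ : Unit => s) (fun _ : Unit => s))
      (.inl ()) (.inr ()) rfl).and (h1.and h2)).or (h1.not.and h2.not)).congr fun v => ?_
    change _ ↔ (lft v () = rgt v () ∧ _) ∨ _
    by_cases hl : lft v () ∈ X <;> by_cases hr : rgt v () ∈ X <;> simp [f, hl, hr]
  have h := (hg Unit (fun _ => s) (fun _ => x)).eq_of_ker f hf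
  by_cases hgx : g.1 s x ∈ X
  · have h' : x = g.1 s x := by simpa [f, show x ∈ X from hx, hgx] using h
    exact h'.symm
  · simp [f, show x ∈ X from hx, hgx] at h

end Homogeneity
end MSLanguage

/-! ### Algebraic closure in the imaginary sorts -/

open scoped Pointwise in
/-- P. M. Neumann's separation lemma: finitely many points with infinite orbits can be moved off any
finite set. Otherwise the group would be covered by finitely many cosets of stabilizers, and one of
these stabilizers would have finite index, by B. H. Neumann's lemma. -/
theorem MulAction.exists_forall_smul_notMem {H X : Type*} [Group H] [MulAction H X] {B C : Set X}
    (hB : B.Finite) (hC : C.Finite) (hinf : ∀ x ∈ B, (MulAction.orbit H x).Infinite) :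
    ∃ h : H, ∀ x ∈ B, h • x ∉ C := by
  classical
  by_contra! hcon
  let T : Finset (X × X) := {p ∈ hB.toFinset ×ˢ hC.toFinset | ∃ h : H, h • p.1 = p.2}
  let g : X × X → H := fun p => if hp : ∃ h : H, h • p.1 = p.2 then hp.choose else 1
  have hcover : ⋃ p ∈ T, g p • (MulAction.stabilizer H p.1 : Set H) = Set.univ := by
    refine Set.eq_univ_of_forall fun h => ?_
    obtain ⟨x, hx, hc⟩ := hcon h
    have hp : ∃ h' : H, h' • (x, h • x).1 = (x, h • x).2 := ⟨h, rfl⟩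
    have hg : g (x, h • x) • x = h • x := by
      simp only [g, dif_pos hp]
      exact hp.choose_spec
    refine Set.mem_iUnion₂.2 ⟨(x, h • x), ?_, ?_⟩
    · simp only [T, Finset.mem_filter, Finset.mem_product, Set.Finite.mem_toFinset]
      exact ⟨⟨hx, hc⟩, hp⟩
    · rw [mem_leftCoset_iff, SetLike.mem_coe, MulAction.mem_stabilizer_iff, mul_smul]
      exact inv_smul_eq_iff.2 hg.symm
  obtain ⟨p, hp, hfin⟩ := Subgroup.exists_finiteIndex_of_leftCoset_cover hcover
  simp only [T, Finset.mem_filter, Finset.mem_product, Set.Finite.mem_toFinset] at hp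
  refine hfin.index_ne_zero ?_
  rw [MulAction.index_stabilizer]
  exact (hinf _ hp.1.1).ncard

namespace MSLanguage

section Actions

variable {S : Type u} (L : MSLanguage.{u, v} S) (M : S → Type w) [L.Structure M]

/-- The imaginaries: the elements of the quotient sorts of `M^eq`. -/
def Imag : Type (max u w) := Σ E : EqSort L M, Quotient E.rel

variable {L M}

/-- The imaginary represented by a tuple. -/
def EqSort.imag (E : EqSort L M) (x : (i : Fin E.arity) → M (E.dom i)) : Imag L M :=
  ⟨E, Quotient.mk E.rel x⟩

theorem Imag.exists_rep (e : Imag L M) : ∃ E : EqSort L M, ∃ x, E.imag x = e := by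
  obtain ⟨E, q⟩ := e
  induction q using Quotient.inductionOn with | h x => exact ⟨E, x, rfl⟩

theorem EqSort.imag_eq_imag {E : EqSort L M} {x y : (i : Fin E.arity) → M (E.dom i)} :
    E.imag x = E.imag y ↔ E.rel x y :=
  ⟨fun h => Quotient.exact (eq_of_heq (Sigma.mk.inj h).2),
    fun h => congrArg (Sigma.mk E) (Quotient.sound h)⟩

theorem EqSort.isDef (E : EqSort L M) : IsDef L
    (fun v : (c : Fin E.arity ⊕ Fin E.arity) → M (Sum.elim E.dom E.dom c) =>
      E.rel (lft v) (rgt v)) := by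
  obtain ⟨φ, hφ⟩ := E.definable
  exact ⟨φ, fun v => (hφ _ _).trans (by rw [pairVal_lft_rgt])⟩

instance : MulAction (Aut L M) (Imag L M) where
  smul g e := ⟨e.1, Aut.eqPerm g (Sum.inr e.1) e.2⟩
  one_smul e := by
    obtain ⟨E, x, rfl⟩ := e.exists_rep
    rfl
  mul_smul g h e := by
    obtain ⟨E, x, rfl⟩ := e.exists_rep
    rfl

theorem EqSort.smul_imag (g : Aut L M) (E : EqSort L M) (x : (i : Fin E.arity) → M (E.dom i)) :
    g • E.imag x = E.imag (fun i => g.1 _ (x i)) := rfl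

instance : MulAction (Aut L M) (Σ s, M s) where
  smul g a := ⟨a.1, g.1 a.1 a.2⟩
  one_smul _ := rfl
  mul_smul _ _ _ := rfl

variable (L) in
/-- The strong automorphisms that fix a given tuple. -/
def strongFixing {β : Type} {τ : β → S} (p : (b : β) → M (τ b)) : Subgroup (Aut L M) where
  carrier := {g | g ∈ strongAut L M ∧ ∀ b, g.1 _ (p b) = p b}
  one_mem' := ⟨one_mem _, fun _ => rfl⟩
  mul_mem' := fun {g h} hg hh => ⟨mul_mem hg.1 hh.1, fun b => by
    change g.1 _ (h.1 _ (p b)) = p b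
    rw [hh.2, hg.2]⟩
  inv_mem' := fun {g} hg => ⟨inv_mem hg.1, fun b => by
    change (g.1 _)⁻¹ (p b) = p b
    rw [Equiv.Perm.inv_eq_iff_eq, hg.2]⟩

end Actions

section AlgebraicClosure

variable {S : Type u} {L : MSLanguage.{u, v} S} {M : S → Type w} [L.Structure M]
variable {β γ : Type} {τ : β → S} {υ : γ → S}

/-- An `∅`-definable property of tuples and parameters that is invariant under the equivalence
relation of the sort `E`, and defines a finite set of imaginaries of this sort for every value of
the parameters. -/
structure EqSort.IsAlg (E : EqSort L M)
    (P : ((i : Fin E.arity) → M (E.dom i)) → ((b : β) → M (τ b)) → Prop) : Prop where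
  isDef : IsDef L (fun v : (c : Fin E.arity ⊕ β) → M (Sum.elim E.dom τ c) => P (lft v) (rgt v))
  invariant : ∀ y y' v, E.rel y y' → P y v → P y' v
  finite : ∀ v, (E.imag '' {y | P y v}).Finite

/-- The imaginary `e` is algebraic over the tuple `p`: it satisfies an instance over `p` of a
property that has finitely many solutions for all parameters. This uniformity costs nothing, since
having at most `k` solutions is a definable condition on the parameters. -/
def AlgOver (p : (b : β) → M (τ b)) (e : Imag L M) : Prop :=
  ∃ P, e.1.IsAlg (τ := τ) P ∧ ∀ x, e.1.imag x = e → P x p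

theorem algOver_imag_iff {p : (b : β) → M (τ b)} {E : EqSort L M}
    {x : (i : Fin E.arity) → M (E.dom i)} :
    AlgOver p (E.imag x) ↔ ∃ P, E.IsAlg (τ := τ) P ∧ P x p := by
  refine exists_congr fun P => and_congr_right fun hP => ⟨fun h => h x rfl, fun h y hy => ?_⟩
  exact hP.invariant x y p (EqSort.imag_eq_imag.1 hy.symm) h

theorem EqSort.IsAlg.aut {E : EqSort L M}
    {P : ((i : Fin E.arity) → M (E.dom i)) → ((b : β) → M (τ b)) → Prop} (hP : E.IsAlg P)
    (g : Aut L M) (x : (i : Fin E.arity) → M (E.dom i)) (p : (b : β) → M (τ b)) :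
    P (fun i => g.1 _ (x i)) (fun b => g.1 _ (p b)) ↔ P x p :=
  hP.isDef.aut g (pairVal x p)

theorem AlgOver.smul {p : (b : β) → M (τ b)} {e : Imag L M} (h : AlgOver p e) (g : Aut L M) :
    AlgOver (fun b => g.1 _ (p b)) (g • e) := by
  obtain ⟨E, x, rfl⟩ := e.exists_rep
  rw [algOver_imag_iff] at h
  obtain ⟨P, hP, hx⟩ := h
  rw [EqSort.smul_imag, algOver_imag_iff]
  exact ⟨P, hP, (hP.aut g x p).2 hx⟩

/-- Algebraicity over a tuple only depends on, and is monotone in, its set of entries. -/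
theorem AlgOver.of_subtuple {p : (b : β) → M (τ b)} {e : Imag L M} (h : AlgOver p e)
    {q : (c : γ) → M (υ c)} (hsub : ∀ b, ∃ c, (⟨τ b, p b⟩ : Σ s, M s) = ⟨υ c, q c⟩) :
    AlgOver q e := by
  choose ρ hρ using hsub
  have hs : ∀ b, υ (ρ b) = τ b := fun b => (congrArg Sigma.fst (hρ b)).symm
  have key : ∀ {s s' : S} (h : s' = s) {a : M s} {a' : M s'},
      (⟨s, a⟩ : Σ s, M s) = ⟨s', a'⟩ → h ▸ a' = a := by
    rintro s _ rfl a a' heq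
    simpa using heq.symm
  have hF : IsReindex (M := M) (σ := τ) (τ := υ) (fun v b => hs b ▸ v (ρ b)) :=
    fun b => ⟨ρ b, hs b, fun _ => rfl⟩
  have hq : (fun b => hs b ▸ q (ρ b)) = p := funext fun b => key (hs b) (hρ b)
  obtain ⟨E, x, rfl⟩ := e.exists_rep
  rw [algOver_imag_iff] at h ⊢
  obtain ⟨P, hP, hx⟩ := h
  exact ⟨fun y v => P y fun b => hs b ▸ v (ρ b),
    ⟨hP.isDef.comap hF.sum_right, fun y y' v => hP.invariant y y' _, fun v => hP.finite _⟩,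
    by
      change P x fun b => hs b ▸ q (ρ b)
      rwa [hq]⟩

/-- The invariance required in `EqSort.IsAlg` can be had for free, by closing a definable property
under the equivalence relation of the sort. -/
theorem EqSort.algOver_imag_of_finite {p : (b : β) → M (τ b)} {E : EqSort L M}
    {x : (i : Fin E.arity) → M (E.dom i)}
    (P : ((i : Fin E.arity) → M (E.dom i)) → ((b : β) → M (τ b)) → Prop)
    (hdef : IsDef L (fun v : (c : Fin E.arity ⊕ β) → M (Sum.elim E.dom τ c) => P (lft v) (rgt v)))
    (hfin : ∀ v, (E.imag '' {y | P y v}).Finite) (hx : P x p) : AlgOver p (E.imag x) := by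
  rw [algOver_imag_iff]
  refine ⟨fun y v => ∃ y', E.rel y' y ∧ P y' v, ⟨?_, ?_, fun v => (hfin v).subset ?_⟩,
    x, E.rel.refl x, hx⟩
  · refine IsDef.exists_tuple (σ := E.dom) (τ := Sum.elim E.dom τ)
      (P := fun y' v => E.rel y' (lft v) ∧ P y' (rgt v)) ((E.isDef.comap
        (F := fun v => pairVal (lft v) (lft (rgt v))) ?_).and
        (hdef.comap (F := fun v => pairVal (lft v) (rgt (rgt v))) ?_))
    · rintro (a | a)
      · exact ⟨.inl a, rfl, fun _ => rfl⟩
      · exact ⟨.inr (.inl a), rfl, fun _ => rfl⟩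
    · rintro (a | a)
      · exact ⟨.inl a, rfl, fun _ => rfl⟩
      · exact ⟨.inr (.inr a), rfl, fun _ => rfl⟩
  · rintro y y' v h ⟨z, hz, hP⟩
    exact ⟨z, E.rel.trans hz h, hP⟩
  · rintro _ ⟨y, ⟨y', h, hP⟩, rfl⟩
    exact ⟨y', hP, EqSort.imag_eq_imag.2 h⟩

/-- An imaginary with a finite orbit under the strong automorphisms fixing a tuple is algebraic
over this tuple. By saturation, membership in the orbit is forced by a single finite equivalence
relation `R`, which provides the required formula. -/
theorem algOver_of_finite_orbit (hcount : Countable (Σ s, M s)) (hsat : IsSaturated L M)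
    [Finite β] {p : (b : β) → M (τ b)} {e : Imag L M}
    (hfin : (MulAction.orbit (strongFixing L p) e).Finite) : AlgOver p e := by
  obtain ⟨E, x, rfl⟩ := e.exists_rep
  -- finitely many tuples representing the conjugates
  obtain ⟨k, z, hz⟩ : ∃ (k : ℕ) (z : Fin k → (i : Fin E.arity) → M (E.dom i)),
      ∀ g ∈ strongFixing L p, ∃ i, E.rel (fun j => g.1 _ (x j)) (z i) := by
    have := hfin.to_subtype
    obtain ⟨k, ⟨f⟩⟩ := Finite.exists_equiv_fin (MulAction.orbit (strongFixing L p) (E.imag x))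
    have h : ∀ o : MulAction.orbit (strongFixing L p) (E.imag x), ∃ y, E.imag y = o.1 := by
      rintro ⟨_, g, rfl⟩
      exact ⟨_, (EqSort.smul_imag g.1 E x).symm⟩
    choose y hy using h
    refine ⟨k, fun i => y (f.symm i), fun g hg => ?_⟩
    let o : MulAction.orbit (strongFixing L p) (E.imag x) :=
      ⟨_, MulAction.mem_orbit _ (⟨g, hg⟩ : strongFixing L p)⟩
    refine ⟨f o, EqSort.imag_eq_imag.1 ?_⟩
    change _ = E.imag (y (f.symm (f o)))
    rw [Equiv.symm_apply_apply, hy]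
    rfl
  -- otherwise saturation yields a conjugate of `x` over `p` in none of the classes of the `z i`
  obtain ⟨R, hR, hRz⟩ : ∃ R : Setoid ((c : Fin E.arity ⊕ β) → M (Sum.elim E.dom τ c)),
      IsFER L R ∧ ∀ y, R (pairVal y p) (pairVal x p) → ∃ i, E.rel y (z i) := by
    by_contra! hcon
    suffices h : ∃ y, ∀ R : {R : Setoid ((c : Fin E.arity ⊕ β) → M (Sum.elim E.dom τ c)) //
        IsFER L R}, R.1 (pairVal y p) (pairVal x p) ∧ ∀ i, ¬ E.rel y (z i) by
      obtain ⟨y, hy⟩ := h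
      have hyx : StrongEq L (pairVal y p) (pairVal x p) := fun R hR => (hy ⟨R, hR⟩).1
      obtain ⟨g, hg, hgx⟩ := hyx.symm.exists_strongAut hcount hsat
      obtain ⟨i, hi⟩ := hz g ⟨hg, fun b => hgx (.inr b)⟩
      rw [show (fun j => g.1 _ (x j)) = y from funext fun j => hgx (.inl j)] at hi
      exact (hy ⟨_, IsFER.ker (fun _ => ()) (IsDef.true.congr fun _ => by simp)⟩).2 i hi
    refine hsat.exists_forall (σ := E.dom)
      (pairVal (pairVal x p) (fun c : Fin k × Fin E.arity => z c.1 c.2))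
      (τ := Sum.elim (Sum.elim E.dom τ) (fun c : Fin k × Fin E.arity => E.dom c.2))
      (P := fun (R : {R : Setoid ((c : Fin E.arity ⊕ β) → M (Sum.elim E.dom τ c)) // IsFER L R})
        y q => R.1 (pairVal y (rgt (lft q))) (lft q) ∧ ∀ i, ¬ E.rel y (fun j => rgt q (i, j)))
      (fun R => ?_) (fun T => ?_)
    · refine (R.2.isDef.comap (F := fun v : (c : Fin E.arity ⊕ ((Fin E.arity ⊕ β) ⊕
          (Fin k × Fin E.arity))) → M (Sum.elim E.dom (Sum.elim (Sum.elim E.dom τ)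
          (fun c => E.dom c.2)) c) =>
          pairVal (pairVal (lft v) (rgt (lft (rgt v)))) (lft (rgt v))) ?_).and
        (IsDef.forall_finite fun i => (E.isDef.comap (F := fun v : (c : Fin E.arity ⊕
          ((Fin E.arity ⊕ β) ⊕ (Fin k × Fin E.arity))) → M (Sum.elim E.dom (Sum.elim
          (Sum.elim E.dom τ) (fun c => E.dom c.2)) c) =>
          pairVal (lft v) (fun j => rgt (rgt v) (i, j))) ?_).not)
      · rintro ((a | a) | (a | a))
        · exact ⟨.inl a, rfl, fun _ => rfl⟩
        · exact ⟨.inr (.inl (.inr a)), rfl, fun _ => rfl⟩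
        · exact ⟨.inr (.inl (.inl a)), rfl, fun _ => rfl⟩
        · exact ⟨.inr (.inl (.inr a)), rfl, fun _ => rfl⟩
      · rintro (a | a)
        · exact ⟨.inl a, rfl, fun _ => rfl⟩
        · exact ⟨.inr (.inr (i, a)), rfl, fun _ => rfl⟩
    · obtain ⟨R, hR, hle⟩ := IsFER.exists_le_finset T
      obtain ⟨y, hy, hyz⟩ := hcon R hR
      exact ⟨y, fun r hr => ⟨hle r hr hy, hyz⟩⟩
  -- the `R`-class of the tuple, for fixed parameters, meets at most `k` classes of `E`
  refine EqSort.algOver_imag_of_finite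
    (fun y v => ∃ z : (c : Fin k × Fin E.arity) → M (E.dom c.2), ∀ y',
      R (pairVal y' v) (pairVal y v) → ∃ i, E.rel y' (fun j => z (i, j))) ?_ ?_
    ⟨fun c => z c.1 c.2, hRz⟩
  · refine IsDef.exists_tuple (σ := fun c : Fin k × Fin E.arity => E.dom c.2)
      (τ := Sum.elim E.dom τ)
      (P := fun z q => ∀ y', R (pairVal y' (rgt q)) q → ∃ i, E.rel y' (fun j => z (i, j)))
      (IsDef.forall_tuple (σ := E.dom)
        (τ := Sum.elim (fun c : Fin k × Fin E.arity => E.dom c.2) (Sum.elim E.dom τ))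
        (P := fun y' q => R (pairVal y' (rgt (rgt q))) (rgt q) →
          ∃ i, E.rel y' (fun j => lft q (i, j)))
        ((hR.isDef.comap (F := fun v => pairVal (pairVal (lft v) (rgt (rgt (rgt v))))
          (rgt (rgt v))) ?_).imp
        (IsDef.exists_finite fun i => E.isDef.comap
          (F := fun v : (c : Fin E.arity ⊕ ((Fin k × Fin E.arity) ⊕ (Fin E.arity ⊕ β))) →
            M (Sum.elim E.dom (Sum.elim (fun c => E.dom c.2) (Sum.elim E.dom τ)) c) =>
            pairVal (lft v) (fun j => lft (rgt v) (i, j))) ?_))) |>.congr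
        fun v => by rw [pairVal_lft_rgt]
    · rintro ((a | a) | (a | a))
      · exact ⟨.inl a, rfl, fun _ => rfl⟩
      · exact ⟨.inr (.inr (.inr a)), rfl, fun _ => rfl⟩
      · exact ⟨.inr (.inr (.inl a)), rfl, fun _ => rfl⟩
      · exact ⟨.inr (.inr (.inr a)), rfl, fun _ => rfl⟩
    · rintro (a | a)
      · exact ⟨.inl a, rfl, fun _ => rfl⟩
      · exact ⟨.inr (.inl (i, a)), rfl, fun _ => rfl⟩
  · -- each `R`-class contributes at most `k` imaginaries
    intro v
    have := hR.finite
    refine (Set.finite_iUnion (ι := Quotient R) (f := fun c => E.imag '' {y |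
      (∃ z : (c : Fin k × Fin E.arity) → M (E.dom c.2), ∀ y', R (pairVal y' v) (pairVal y v) →
        ∃ i, E.rel y' (fun j => z (i, j))) ∧ Quotient.mk R (pairVal y v) = c}) fun c => ?_).subset
      fun o ho => ?_
    · rcases Set.eq_empty_or_nonempty {y | (∃ z : (c : Fin k × Fin E.arity) → M (E.dom c.2),
        ∀ y', R (pairVal y' v) (pairVal y v) → ∃ i, E.rel y' (fun j => z (i, j))) ∧
          Quotient.mk R (pairVal y v) = c} with h | ⟨y₀, ⟨z₀, hz₀⟩, rfl⟩
      · rw [h, Set.image_empty]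
        exact Set.finite_empty
      · refine (Set.finite_range fun i => E.imag fun j => z₀ (i, j)).subset ?_
        rintro _ ⟨y, ⟨-, hy⟩, rfl⟩
        obtain ⟨i, hi⟩ := hz₀ y (Quotient.exact hy)
        exact ⟨i, EqSort.imag_eq_imag.2 (E.rel.symm hi)⟩
    · obtain ⟨y, hy, rfl⟩ := ho
      exact Set.mem_iUnion.2 ⟨_, y, ⟨hy, rfl⟩, rfl⟩

/-- A finite set of imaginaries defined over a larger tuple can be cut down so as to avoid the
imaginaries algebraic over a subtuple: take a defining property with as few solutions as possible.
-/
theorem AlgOver.exists_isAlg_forall_not_algOver {a : (c : γ) → M (υ c)} {b : (c : β) → M (τ c)}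
    {E : EqSort L M} {x : (i : Fin E.arity) → M (E.dom i)} (h : AlgOver (pairVal a b) (E.imag x))
    (hb : ¬ AlgOver b (E.imag x)) :
    ∃ χ, E.IsAlg (τ := Sum.elim υ τ) χ ∧ χ x (pairVal a b) ∧
      ∀ z, χ z (pairVal a b) → ¬ AlgOver b (E.imag z) := by
  obtain ⟨χ, ⟨hχ, hx⟩, hmin⟩ := exists_minimalFor_of_wellFoundedLT
    (fun χ : ((i : Fin E.arity) → M (E.dom i)) → ((c : γ ⊕ β) → M (Sum.elim υ τ c)) → Prop =>
      E.IsAlg χ ∧ χ x (pairVal a b)) (fun χ => (E.imag '' {y | χ y (pairVal a b)}).ncard)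
    (algOver_imag_iff.1 h)
  refine ⟨χ, hχ, hx, fun z hz hzb => ?_⟩
  obtain ⟨θ, hθ, hzθ⟩ := algOver_imag_iff.1 hzb
  have hsub : ∀ v, E.imag '' {y | χ y v ∧ ¬ θ y (rgt v)} ⊆ E.imag '' {y | χ y v} :=
    fun v => Set.image_mono fun y hy => hy.1
  have halg : E.IsAlg (fun y (v : (c : γ ⊕ β) → M (Sum.elim υ τ c)) => χ y v ∧ ¬ θ y (rgt v)) := by
    refine ⟨hχ.isDef.and (hθ.isDef.comap (F := fun v => pairVal (lft v) (rgt (rgt v))) ?_).not,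
      fun y y' v hyy' hy => ⟨hχ.invariant y y' v hyy' hy.1, fun hy' =>
        hy.2 (hθ.invariant y' y _ (E.rel.symm hyy') hy')⟩, fun v => (hχ.finite v).subset (hsub v)⟩
    rintro (i | i)
    · exact ⟨.inl i, rfl, fun _ => rfl⟩
    · exact ⟨.inr (.inr i), rfl, fun _ => rfl⟩
  have hle := hmin (j := fun y v => χ y v ∧ ¬ θ y (rgt v))
    ⟨halg, hx, fun hxθ => hb (algOver_imag_iff.2 ⟨θ, hθ, hxθ⟩)⟩
    (Set.ncard_le_ncard (hsub _) (hχ.finite _))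
  have heq := Set.eq_of_subset_of_ncard_le (hsub _) hle (hχ.finite _)
  have hmem : E.imag z ∈ E.imag '' {y | χ y (pairVal a b)} := ⟨z, hz, rfl⟩
  rw [← heq] at hmem
  obtain ⟨y, ⟨-, hy⟩, hyz⟩ := hmem
  exact hy (hθ.invariant z y _ (EqSort.imag_eq_imag.1 hyz.symm) hzθ)

/-- The element `d` has a conjugate `h d` over `b` such that everything algebraic both over `b, h d`
and over `a, b` is already algebraic over `b`. The element `h d` realizes the partial type saying
that it has the strong type of `d` over `b`, and that no instance over `b, h d` of an algebraic
property meets a finite set of imaginaries that is defined over `a, b` and contains nothing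
algebraic over `b`. -/
theorem exists_strongFixing_algOver (hcount : Countable (Σ s, M s)) (hsat : IsSaturated L M)
    [Finite β] [Finite γ] (a : (c : γ) → M (υ c)) (b : (c : β) → M (τ c)) {s : S} (d : M s) :
    ∃ h ∈ strongFixing L b, ∀ e : Imag L M, AlgOver (extendVal (h.1 s d) b) e →
      AlgOver (pairVal a b) e → AlgOver b e := by
  suffices hy : ∃ y : M s, StrongEq L (extendVal y b) (extendVal d b) ∧
      ∀ (E : EqSort L M) P χ, E.IsAlg (τ := extend τ s) P → E.IsAlg (τ := Sum.elim υ τ) χ →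
        (∀ z, χ z (pairVal a b) → ¬ AlgOver b (E.imag z)) →
          ∀ z, ¬ (χ z (pairVal a b) ∧ P z (extendVal y b)) by
    obtain ⟨y, hyd, hy⟩ := hy
    obtain ⟨h, hh, hhd⟩ := hyd.symm.exists_strongAut hcount hsat
    refine ⟨h, ⟨hh, fun c => hhd (some c)⟩, fun e he₁ he₂ => ?_⟩
    rw [show h.1 s d = y from hhd none] at he₁
    obtain ⟨E, x, rfl⟩ := e.exists_rep
    by_contra hcon
    obtain ⟨χ, hχ, hx, hχb⟩ := he₂.exists_isAlg_forall_not_algOver hcon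
    obtain ⟨P, hP, hxP⟩ := algOver_imag_iff.1 he₁
    exact hy E P χ hP hχ hχb x ⟨hx, hxP⟩
  let J := Σ E : EqSort L M,
    {P : ((i : Fin E.arity) → M (E.dom i)) → ((c : Option β) → M (extend τ s c)) → Prop //
      E.IsAlg P} ×
    {χ : ((i : Fin E.arity) → M (E.dom i)) → ((c : γ ⊕ β) → M (Sum.elim υ τ c)) → Prop //
      E.IsAlg χ ∧ ∀ z, χ z (pairVal a b) → ¬ AlgOver b (E.imag z)}
  let I := {R : Setoid ((c : Option β) → M (extend τ s c)) // IsFER L R} ⊕ J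
  let Q : I → M s → ((c : Option (γ ⊕ β)) → M (extend (Sum.elim υ τ) s c)) → Prop := fun i y q =>
    match i with
    | .inl R => R.1 (extendVal y fun c => q (some (.inr c)))
        (extendVal (q none) fun c => q (some (.inr c)))
    | .inr j => ∀ z, ¬ (j.2.2.1 z (fun c => q (some c)) ∧
        j.2.1.1 z (extendVal y fun c => q (some (.inr c))))
  suffices hy : ∃ y, ∀ i, Q i y (extendVal d (pairVal a b)) by
    obtain ⟨y, hy⟩ := hy
    exact ⟨y, fun R hR => hy (.inl ⟨R, hR⟩),
      fun E P χ hP hχ hχb => hy (.inr ⟨E, ⟨P, hP⟩, ⟨χ, hχ, hχb⟩⟩)⟩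
  refine hsat.exists_forall_one _ ?_ fun T => ?_
  · rintro (R | ⟨E, P, χ⟩)
    · refine R.2.isDef.comap (F := fun v : (c : Option (Option (γ ⊕ β))) →
        M (extend (extend (Sum.elim υ τ) s) s c) => pairVal
          (extendVal (M := M) (v none) fun c => v (some (some (.inr c))))
          (extendVal (M := M) (v (some none)) fun c => v (some (some (.inr c))))) ?_
      rintro ((_ | c) | (_ | c))
      · exact ⟨none, rfl, fun _ => rfl⟩
      · exact ⟨some (some (.inr c)), rfl, fun _ => rfl⟩
      · exact ⟨some none, rfl, fun _ => rfl⟩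
      · exact ⟨some (some (.inr c)), rfl, fun _ => rfl⟩
    · refine IsDef.forall_tuple (σ := E.dom) (τ := extend (extend (Sum.elim υ τ) s) s)
        (P := fun z v => ¬ (χ.1 z (fun c => v (some (some c))) ∧
          P.1 z (extendVal (v none) fun c => v (some (some (.inr c))))))
        ((χ.2.1.isDef.comap (F := fun v : (c : Fin E.arity ⊕ Option (Option (γ ⊕ β))) →
            M (Sum.elim E.dom (extend (extend (Sum.elim υ τ) s) s) c) =>
            pairVal (lft v) (fun c => rgt v (some (some c)))) ?_).and
          (P.2.isDef.comap (F := fun v : (c : Fin E.arity ⊕ Option (Option (γ ⊕ β))) →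
            M (Sum.elim E.dom (extend (extend (Sum.elim υ τ) s) s) c) =>
            pairVal (lft v) (extendVal (M := M) (rgt v none)
              fun c => rgt v (some (some (.inr c))))) ?_)).not
      · rintro (i | c)
        · exact ⟨.inl i, rfl, fun _ => rfl⟩
        · exact ⟨.inr (some (some c)), rfl, fun _ => rfl⟩
      · rintro (i | (_ | c))
        · exact ⟨.inl i, rfl, fun _ => rfl⟩
        · exact ⟨.inr none, rfl, fun _ => rfl⟩
        · exact ⟨.inr (some (some (.inr c))), rfl, fun _ => rfl⟩
  · -- finite satisfiability: move the finitely many solutions over `b, d` that are not algebraic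
    -- over `b` off the finitely many forbidden imaginaries, by an element of the stabilizer of `b`
    let f : J → Set (Imag L M) := fun j =>
      {e ∈ j.1.imag '' {z | j.2.1.1 z (extendVal d b)} | ¬ AlgOver b e}
    let f' : J → Set (Imag L M) := fun j => j.1.imag '' {z | j.2.2.1 z (pairVal a b)}
    have hT : {j : J | Sum.inr j ∈ T}.Finite :=
      T.finite_toSet.preimage Sum.inr_injective.injOn
    obtain ⟨h, hh⟩ := MulAction.exists_forall_smul_notMem (H := strongFixing L b)
      (B := ⋃ j ∈ {j : J | Sum.inr j ∈ T}, f j) (C := ⋃ j ∈ {j : J | Sum.inr j ∈ T}, f' j)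
      (hT.biUnion fun j _ => (j.2.1.2.finite _).subset fun e he => he.1)
      (hT.biUnion fun j _ => j.2.2.2.1.finite _) (by
        intro e he hfin
        obtain ⟨j, _, -, he⟩ := Set.mem_iUnion₂.1 he
        exact he (algOver_of_finite_orbit hcount hsat hfin))
    have hb : (fun c => h.1.1 _ (extendVal (M := M) d b c)) = extendVal (h.1.1 s d) b := by
      funext c
      rcases c with _ | c
      · rfl
      · exact h.2.2 c
    refine ⟨h.1.1 s d, ?_⟩
    rintro (R | j) hi
    · have hst := h.2.1 _ _ (extendVal d b)
      rw [hb] at hst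
      exact hst.symm R.1 R.2
    · rintro z ⟨hz, hz'⟩
      have hz'' : (fun i => h.1.1 _ ((h⁻¹).1.1 _ (z i))) = z :=
        funext fun i => (h.1.1 _).apply_symm_apply (z i)
      have hP : j.2.1.1 (fun i => (h⁻¹).1.1 _ (z i)) (extendVal d b) := by
        rw [← j.2.1.2.aut h.1, hb, hz'']
        exact hz'
      refine hh (j.1.imag fun i => (h⁻¹).1.1 _ (z i))
        (Set.mem_iUnion₂.2 ⟨j, hi, ⟨_, hP, rfl⟩, fun halg => ?_⟩)
        (Set.mem_iUnion₂.2 ⟨j, hi, z, hz, ?_⟩)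
      · have := halg.smul h.1
        rw [EqSort.smul_imag, hz'', show (fun c => h.1.1 _ (b c)) = b from funext h.2.2] at this
        exact j.2.2.2.2 z hz this
      · exact (congrArg j.1.imag hz'').symm

end AlgebraicClosure
end MSLanguage

/-! ### Free actions from an independent closure -/

section FreeActions

open FreeGroup

variable {ι G Ω X : Type*}

/-- The inverse of a letter of a free group. -/
def flipLetter (l : ι × Bool) : ι × Bool := (l.1, !l.2)

/-- In a graph with edges labelled by `ι`, the letter `(i, true)` leads along an edge labelled `i`,
the letter `(i, false)` leads against it. -/
def LetterStep (E : ι → X → X → Prop) (l : ι × Bool) (x y : X) : Prop :=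
  if l.2 then E l.1 x y else E l.1 y x

theorem letterStep_flipLetter {E : ι → X → X → Prop} {l : ι × Bool} {x y : X} :
    LetterStep E (flipLetter l) x y ↔ LetterStep E l y x := by
  rcases l with ⟨i, _ | _⟩ <;> rfl

/-- A cyclically reduced closed path, of positive length `n + 1`, with vertices `x` and letters `l`,
indexed cyclically. -/
def IsReducedCycle (E : ι → X → X → Prop) {n : ℕ} (x : Fin (n + 1) → X)
    (l : Fin (n + 1) → ι × Bool) : Prop :=
  ∀ k, LetterStep E (l k) (x k) (x (k + 1)) ∧ l (k + 1) ≠ flipLetter (l k)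

/-- Reduced cycles cannot use an edge one of whose ends is a leaf. -/
theorem IsReducedCycle.of_leaf {E E' : ι → X → X → Prop}
    (hleaf : ∀ i x y, E' i x y → ¬ E i x y →
      (∀ l z, LetterStep E' l x z → l = (i, true)) ∨
        ∀ l z, LetterStep E' l y z → l = (i, false))
    {n : ℕ} {x : Fin (n + 1) → X} {l : Fin (n + 1) → ι × Bool} (h : IsReducedCycle E' x l) :
    IsReducedCycle E x l := by
  have hleaf' : ∀ l x y, LetterStep E' l x y → ¬ LetterStep E l x y →
      (∀ l' z, LetterStep E' l' x z → l' = l) ∨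
        ∀ l' z, LetterStep E' l' y z → l' = flipLetter l := by
    rintro ⟨i, _ | _⟩ x y h₁ h₂
    · exact (hleaf i y x h₁ h₂).symm
    · exact hleaf i x y h₁ h₂
  refine fun k => ⟨?_, (h k).2⟩
  by_contra hk
  rcases hleaf' _ _ _ (h k).1 hk with hl | hl
  · have h₁ := (h (k - 1)).1
    have h₂ := (h (k - 1)).2
    rw [sub_add_cancel] at h₁ h₂
    exact h₂ (hl _ _ (letterStep_flipLetter.2 h₁)).symm
  · exact (h k).2 (hl _ _ (h (k + 1)).1)

variable [Group G] [MulAction G X]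

/-- A fixed point of a cyclically reduced non-trivial word lies on a reduced cycle. The letters act
starting with the last one, so the cycle traced out by applying the inverses of the letters,
starting with the first one, is used. -/
theorem FreeGroup.IsCyclicallyReduced.exists_isReducedCycle {F : ι → G} {L : List (ι × Bool)}
    (hL : IsCyclicallyReduced L) (hne : L ≠ []) {y : X}
    (hy : FreeGroup.lift F (FreeGroup.mk L) • y = y) :
    ∃ (n : ℕ) (x : Fin (n + 1) → X) (l : Fin (n + 1) → ι × Bool), x 0 = y ∧
      IsReducedCycle (fun i x y => y = F i • x) x l := by
  obtain ⟨n, hn⟩ : ∃ n, L.length = n + 1 :=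
    Nat.exists_eq_succ_of_ne_zero fun h => hne (List.length_eq_zero_iff.1 h)
  have hlen : ∀ k : Fin (n + 1), (k : ℕ) < L.length := fun k => by
    rw [hn]
    exact k.isLt
  let z : ℕ → X := fun m => (FreeGroup.lift F (FreeGroup.mk (L.take m)))⁻¹ • y
  have hz0 : z 0 = y := by
    change (FreeGroup.lift F 1)⁻¹ • y = y
    rw [_root_.map_one, inv_one, one_smul]
  have hzn : z (n + 1) = y := by
    change (FreeGroup.lift F (FreeGroup.mk (L.take (n + 1))))⁻¹ • y = y
    rw [← hn, List.take_length, inv_smul_eq_iff, hy]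
  have hzs : ∀ m (hm : m < L.length), LetterStep (fun i x y => y = F i • x)
      (flipLetter L[m]) (z m) (z (m + 1)) := by
    intro m hm
    have h : FreeGroup.lift F (FreeGroup.mk (L.take (m + 1))) =
        FreeGroup.lift F (FreeGroup.mk (L.take m)) * cond L[m].2 (F L[m].1) (F L[m].1)⁻¹ := by
      rw [List.take_add_one, List.getElem?_eq_getElem hm, Option.toList_some,
        ← FreeGroup.mul_mk, _root_.map_mul]
      simp [FreeGroup.lift_mk]
    have h' : z m = cond L[m].2 (F L[m].1) (F L[m].1)⁻¹ • z (m + 1) := by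
      simp only [z, h, mul_inv_rev, mul_smul, smul_inv_smul]
    rw [letterStep_flipLetter, h', LetterStep]
    cases h2 : L[m].2 <;> simp
  have hsucc : ∀ k : Fin (n + 1), z (k + 1 : Fin (n + 1)) = z (k + 1 : ℕ) := by
    intro k
    rw [Fin.val_add_one]
    split_ifs with hk
    · rw [hk, hz0, Fin.val_last, hzn]
    · rfl
  refine ⟨n, fun k => z k, fun k => flipLetter (L[(k : ℕ)]'(hlen k)), hz0, fun k => ⟨?_, ?_⟩⟩
  · change LetterStep _ _ (z k) (z (k + 1 : Fin (n + 1)))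
    rw [hsucc]
    exact hzs k (hlen k)
  · intro heq
    have h1 : (L[(k : ℕ)]'(hlen k)).1 = (L[((k + 1 : Fin (n + 1)) : ℕ)]'(hlen (k + 1))).1 :=
      (congrArg Prod.fst heq).symm
    have h2 : (L[(k : ℕ)]'(hlen k)).2 = !(L[((k + 1 : Fin (n + 1)) : ℕ)]'(hlen (k + 1))).2 := by
      have := congrArg Prod.snd heq
      simp only [flipLetter, Bool.not_not] at this
      exact this.symm
    by_cases hk : k = Fin.last n
    · subst hk
      have h3 : ((Fin.last n + 1 : Fin (n + 1)) : ℕ) = 0 := by simp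
      simp only [h3] at h1 h2
      have := hL.2 _ (by rw [List.getLast?_eq_getElem?, List.getElem?_eq_getElem (by omega)]; rfl)
        _ (by rw [List.head?_eq_getElem?, List.getElem?_eq_getElem (by omega)]; rfl)
      simp only [hn, Nat.add_sub_cancel] at this
      simp only [Fin.val_last] at h1 h2
      rw [this h1] at h2
      simp at h2
    · have h3 : ((k + 1 : Fin (n + 1)) : ℕ) = k + 1 := by
        rw [Fin.val_add_one, if_neg hk]
      simp only [h3] at h1 h2
      have hlt : (k : ℕ) + 1 < L.length := by
        have := Fin.val_lt_last hk
        omega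
      have := (List.isChain_iff_getElem.1 hL.1) k hlt
      rw [this h1] at h2
      simp at h2

variable [MulAction G Ω]

/-- An abstract algebraic closure for the action of a group `G` on two sets: it assigns to a set of
elements of `Ω` a set of elements of `X`. The axiom `exists_smul` provides, for `B ⊆ A`, a conjugate
of `d` over `B` that is independent of `A` over `B`, and `exists_of_finite` says that a permutation
of `Ω` that agrees with elements of `G` on finite sets is induced by an element of `G`. -/
structure IsIndependentClosure (G : Type*) {Ω X : Type*} [Group G] [MulAction G Ω] [MulAction G X]
    (cl : Set Ω → Set X) : Prop where
  mono : Monotone cl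
  smul_mem : ∀ (g : G) {A : Set Ω} {x : X}, x ∈ cl A → g • x ∈ cl ((fun a => g • a) '' A)
  exists_finite : ∀ x, ∃ A : Set Ω, A.Finite ∧ x ∈ cl A
  exists_smul : ∀ A B : Set Ω, A.Finite → B ⊆ A → ∀ d : Ω, ∃ h : G, (∀ b ∈ B, h • b = b) ∧
    ∀ x ∈ cl (insert (h • d) B), x ∈ cl A → x ∈ cl B
  exists_of_finite : ∀ Γ : Set (Ω × Ω), (∀ T ⊆ Γ, T.Finite → ∃ g : G, ∀ p ∈ T, g • p.1 = p.2) →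
    (∀ a, ∃ b, (a, b) ∈ Γ) → (∀ b, ∃ a, (a, b) ∈ Γ) → ∃ g : G, ∀ p ∈ Γ, g • p.1 = p.2

variable {cl : Set Ω → Set X}

namespace IsIndependentClosure

theorem smul_mem_image_iff (hcl : IsIndependentClosure G cl) (g : G) {A : Set Ω} {x : X} :
    g • x ∈ cl ((fun a => g • a) '' A) ↔ x ∈ cl A := by
  refine ⟨fun h => ?_, hcl.smul_mem g⟩
  have := hcl.smul_mem g⁻¹ h
  rwa [inv_smul_smul, Set.image_image, show (fun a : Ω => g⁻¹ • g • a) = id from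
    funext fun a => inv_smul_smul g a, Set.image_id] at this

theorem smul_mem_empty_iff (hcl : IsIndependentClosure G cl) (g : G) {x : X} :
    g • x ∈ cl ∅ ↔ x ∈ cl ∅ := by
  simpa using hcl.smul_mem_image_iff g (A := ∅) (x := x)

end IsIndependentClosure

/-- The edges `x → F i • x` with `x` in the closure of `A i`: those determined, up to the action of
the stabilizer of `A i`, by the restriction of `F i` to `A i`. -/
def ControlledEdge (cl : Set Ω → Set X) (F : ι → G) (A : ι → Set Ω) (i : ι) (x y : X) : Prop :=
  x ∈ cl (A i) ∧ y = F i • x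

/-- A forcing condition for a free action: the restrictions of the group elements `F i` to the
finite sets `A i`, such that no extensions of these restrictions create a reduced cycle of
controlled edges outside the closure of the empty set. -/
structure FreeCondition (ι G : Type*) {Ω X : Type*} [Group G] [MulAction G Ω] [MulAction G X]
    (cl : Set Ω → Set X) where
  elt : ι → G
  dom : ι → Set Ω
  finite : ∀ i, (dom i).Finite
  acyclic : ∀ F : ι → G, (∀ i, ∀ a ∈ dom i, F i • a = elt i • a) →
    ∀ (n : ℕ) (x : Fin (n + 1) → X) (l : Fin (n + 1) → ι × Bool),
      IsReducedCycle (ControlledEdge cl F dom) x l → x 0 ∈ cl ∅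

namespace FreeCondition

instance : Preorder (FreeCondition ι G cl) where
  le p q := ∀ i, p.dom i ⊆ q.dom i ∧ ∀ a ∈ p.dom i, q.elt i • a = p.elt i • a
  le_refl p i := ⟨subset_rfl, fun _ _ => rfl⟩
  le_trans p q r hpq hqr i := ⟨(hpq i).1.trans (hqr i).1, fun a ha =>
    ((hqr i).2 a ((hpq i).1 ha)).trans ((hpq i).2 a ha)⟩

/-- The condition without constraints. -/
def bot (hcl : IsIndependentClosure G cl) : FreeCondition ι G cl where
  elt _ := 1
  dom _ := ∅
  finite _ := Set.finite_empty
  acyclic F _ n x l h := by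
    have h0 := (h 0).1
    rcases hl : l 0 with ⟨i, _ | _⟩
    · rw [hl] at h0
      obtain ⟨h1, h2⟩ : _ ∧ _ := h0
      rw [h2]
      exact hcl.smul_mem _ h1 |> fun h => by simpa using h
    · rw [hl] at h0
      exact h0.1

/-- The elements of `Ω` that a condition talks about. -/
def support (p : FreeCondition ι G cl) : Set Ω :=
  ⋃ i, p.dom i ∪ (fun a => p.elt i • a) '' p.dom i

theorem finite_support [Finite ι] (p : FreeCondition ι G cl) : p.support.Finite :=
  Set.finite_iUnion fun i => (p.finite i).union ((p.finite i).image _)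

theorem dom_subset_support (p : FreeCondition ι G cl) (i : ι) : p.dom i ⊆ p.support :=
  Set.subset_union_left.trans (Set.subset_iUnion_of_subset i subset_rfl)

theorem image_subset_support (p : FreeCondition ι G cl) (i : ι) :
    (fun a => p.elt i • a) '' p.dom i ⊆ p.support :=
  Set.subset_union_right.trans (Set.subset_iUnion_of_subset i subset_rfl)

/-- The domain of the `j`-th map can be extended by `c`, with value `f • c`, if all new controlled
edges have their source, or all have their target, outside the closure of everything else: such an
end point is a leaf of the graph of controlled edges. -/
theorem exists_le_of_leaf (p : FreeCondition ι G cl) (hcl : IsIndependentClosure G cl) (j : ι)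
    (f : G) (hf : ∀ a ∈ p.dom j, f • a = p.elt j • a) (c : Ω)
    (hleaf : (∀ x ∈ cl (insert c (p.dom j)), x ∈ cl (insert (f • c) p.support) → x ∈ cl (p.dom j)) ∨
      ∀ x ∈ cl (insert (f • c) ((fun a => p.elt j • a) '' p.dom j)),
        x ∈ cl (insert c p.support) → x ∈ cl ((fun a => p.elt j • a) '' p.dom j)) :
    ∃ q : FreeCondition ι G cl, p ≤ q ∧ c ∈ q.dom j ∧ q.elt j = f := by
  classical
  refine ⟨⟨Function.update p.elt j f, Function.update p.dom j (insert c (p.dom j)), fun i => ?_,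
    fun F hF n x l h => ?_⟩, fun i => ?_, by simp, by simp⟩
  · rcases eq_or_ne i j with rfl | hi
    · simpa using (p.finite i).insert c
    · simpa [hi] using p.finite i
  · have hFc : F j • c = f • c := by simpa using hF j c (by simp)
    have hF' : ∀ i, ∀ a ∈ p.dom i, F i • a = p.elt i • a := by
      intro i a ha
      rcases eq_or_ne i j with rfl | hi
      · rw [← hf a ha]
        simpa using hF i a (by simp [ha])
      · simpa [hi] using hF i a (by simpa [hi] using ha)
    have himage : ∀ i, (fun a => F i • a) '' p.dom i = (fun a => p.elt i • a) '' p.dom i :=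
      fun i => Set.image_congr (hF' i)
    have himagej : (fun a => F j • a) '' insert c (p.dom j) =
        insert (f • c) ((fun a => p.elt j • a) '' p.dom j) := by
      rw [Set.image_insert_eq, himage, hFc]
    -- the closure of the support contains both ends of every controlled edge of another label
    have hother : ∀ i ≠ j, ∀ x y, ControlledEdge cl F
        (Function.update p.dom j (insert c (p.dom j))) i x y →
        x ∈ cl p.support ∧ y ∈ cl p.support := by
      rintro i hi x y ⟨hx, rfl⟩
      rw [Function.update_of_ne hi] at hx
      refine ⟨hcl.mono (p.dom_subset_support i) hx, hcl.mono (p.image_subset_support i) ?_⟩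
      rw [← himage]
      exact hcl.smul_mem _ hx
    have hsame : ∀ x y, ControlledEdge cl F
        (Function.update p.dom j (insert c (p.dom j))) j x y →
        x ∈ cl (insert c (p.dom j)) ∧
          y ∈ cl (insert (f • c) ((fun a => p.elt j • a) '' p.dom j)) := by
      rintro x y ⟨hx, rfl⟩
      rw [Function.update_self] at hx
      refine ⟨hx, ?_⟩
      rw [← himagej]
      exact hcl.smul_mem _ hx
    refine p.acyclic F hF' n x l (h.of_leaf fun i x y hnew hold => ?_)
    obtain rfl : i = j := by
      by_contra hi
      refine hold ⟨?_, hnew.2⟩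
      have := hnew.1
      rwa [Function.update_of_ne hi] at this
    have hx : x ∉ cl (p.dom i) := fun hx => hold ⟨hx, hnew.2⟩
    have hy : y ∉ cl ((fun a => p.elt i • a) '' p.dom i) := by
      rw [hnew.2, ← himage, hcl.smul_mem_image_iff]
      exact hx
    refine hleaf.imp (fun hl => ?_) (fun hl => ?_)
    · have hx' : x ∉ cl (insert (f • c) p.support) := fun h => hx (hl x (hsame x y hnew).1 h)
      rintro ⟨i', _ | _⟩ z hz
      · exfalso
        have hz' : ControlledEdge cl F _ i' z x := hz
        rcases eq_or_ne i' i with rfl | hi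
        · exact hx' (hcl.mono (Set.insert_subset_insert (p.image_subset_support _))
            (hsame z x hz').2)
        · exact hx' (hcl.mono (Set.subset_insert _ _) (hother i' hi z x hz').2)
      · have hz' : ControlledEdge cl F _ i' x z := hz
        rcases eq_or_ne i' i with rfl | hi
        · rfl
        · exact (hx' (hcl.mono (Set.subset_insert _ _) (hother i' hi x z hz').1)).elim
    · have hy' : y ∉ cl (insert c p.support) := fun h => hy (hl y (hsame x y hnew).2 h)
      rintro ⟨i', _ | _⟩ z hz
      · have hz' : ControlledEdge cl F _ i' z y := hz
        rcases eq_or_ne i' i with rfl | hi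
        · rfl
        · exact (hy' (hcl.mono (Set.subset_insert _ _) (hother i' hi z y hz').2)).elim
      · exfalso
        have hz' : ControlledEdge cl F _ i' y z := hz
        rcases eq_or_ne i' i with rfl | hi
        · exact hy' (hcl.mono (Set.insert_subset_insert (p.dom_subset_support _))
            (hsame y z hz').1)
        · exact hy' (hcl.mono (Set.subset_insert _ _) (hother i' hi y z hz').1)
  · rcases eq_or_ne i j with rfl | hi
    · simpa using hf
    · simp [hi]

/-- Any element can be added to a domain: its image is chosen independent, over the old range, of
everything else, so that the targets of the new edges are leaves. -/
theorem exists_mem_dom [Finite ι] (p : FreeCondition ι G cl) (hcl : IsIndependentClosure G cl)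
    (j : ι) (c : Ω) : ∃ q : FreeCondition ι G cl, p ≤ q ∧ c ∈ q.dom j := by
  obtain ⟨h, hfix, hh⟩ := hcl.exists_smul (insert c p.support) _ (p.finite_support.insert c)
    ((p.image_subset_support j).trans (Set.subset_insert _ _)) (p.elt j • c)
  obtain ⟨q, hpq, hc, -⟩ := p.exists_le_of_leaf hcl j (h * p.elt j)
    (fun a ha => by rw [mul_smul, hfix _ ⟨a, ha, rfl⟩]) c (Or.inr (by rwa [mul_smul]))
  exact ⟨q, hpq, hc⟩

/-- Any element can be added to a range: its preimage is chosen independent, over the old domain, of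
everything else, so that the sources of the new edges are leaves. -/
theorem exists_mem_image [Finite ι] (p : FreeCondition ι G cl) (hcl : IsIndependentClosure G cl)
    (j : ι) (c : Ω) : ∃ q : FreeCondition ι G cl, p ≤ q ∧ ∃ a ∈ q.dom j, q.elt j • a = c := by
  obtain ⟨h, hfix, hh⟩ := hcl.exists_smul (insert c p.support) _ (p.finite_support.insert c)
    ((p.dom_subset_support j).trans (Set.subset_insert _ _)) ((p.elt j)⁻¹ • c)
  have hc : (p.elt j * h⁻¹) • h • (p.elt j)⁻¹ • c = c := by
    rw [mul_smul, inv_smul_smul, smul_inv_smul]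
  obtain ⟨q, hpq, hd, hq⟩ := p.exists_le_of_leaf hcl j (p.elt j * h⁻¹)
    (fun a ha => by rw [mul_smul, inv_smul_eq_iff.2 (hfix a ha).symm]) (h • (p.elt j)⁻¹ • c)
    (Or.inl (by rwa [hc]))
  exact ⟨q, hpq, _, hd, by rw [hq, hc]⟩

end FreeCondition

/-- A countable set with an independent closure carries a free group of finite rank that acts freely
outside the closure of the empty set. -/
theorem IsIndependentClosure.exists_free (hcl : IsIndependentClosure G cl) [Countable Ω]
    (ι : Type*) [Finite ι] :
    ∃ F : ι → G, ∀ u : FreeGroup ι, u ≠ 1 → ∀ x ∉ cl ∅, FreeGroup.lift F u • x ≠ x := by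
  classical
  have := Encodable.ofCountable ((ι × Ω) ⊕ (ι × Ω))
  let D : (ι × Ω) ⊕ (ι × Ω) → Order.Cofinal (FreeCondition ι G cl)
    | .inl a => ⟨{q | a.2 ∈ q.dom a.1}, fun p => by
        obtain ⟨q, hpq, hq⟩ := p.exists_mem_dom hcl a.1 a.2
        exact ⟨q, hq, hpq⟩⟩
    | .inr c => ⟨{q | ∃ a ∈ q.dom c.1, q.elt c.1 • a = c.2}, fun p => by
        obtain ⟨q, hpq, hq⟩ := p.exists_mem_image hcl c.1 c.2
        exact ⟨q, hq, hpq⟩⟩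
  let p := Order.sequenceOfCofinals (FreeCondition.bot hcl) D
  have hmono : Monotone p := Order.sequenceOfCofinals.monotone _ D
  have hdom : ∀ i a, ∃ n, a ∈ (p n).dom i := fun i a =>
    ⟨_, Order.sequenceOfCofinals.encode_mem (FreeCondition.bot hcl) D (.inl (i, a))⟩
  have hran : ∀ i c, ∃ n, ∃ a ∈ (p n).dom i, (p n).elt i • a = c := fun i c =>
    ⟨_, Order.sequenceOfCofinals.encode_mem (FreeCondition.bot hcl) D (.inr (i, c))⟩
  have hlim : ∀ i, ∃ g : G, ∀ n, ∀ a ∈ (p n).dom i, g • a = (p n).elt i • a := by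
    intro i
    refine (hcl.exists_of_finite
      {q | ∃ n, q.1 ∈ (p n).dom i ∧ q.2 = (p n).elt i • q.1} ?_ ?_ ?_).imp
      fun g hg n a ha => hg (a, _) ⟨n, ha, rfl⟩
    · intro T hT hfin
      choose! n hn using hT
      obtain ⟨N, hN⟩ := (hfin.image n).bddAbove
      refine ⟨(p N).elt i, fun q hq => ?_⟩
      rw [(hn hq).2]
      exact ((hmono (hN ⟨q, hq, rfl⟩)) i).2 _ (hn hq).1
    · intro a
      obtain ⟨n, hn⟩ := hdom i a
      exact ⟨(p n).elt i • a, n, hn, rfl⟩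
    · intro c
      obtain ⟨n, a, ha, rfl⟩ := hran i c
      exact ⟨a, n, ha, rfl⟩
  choose F hF using hlim
  -- a reduced cycle involves finitely many points, hence is controlled by some condition
  have hacyclic : ∀ (n : ℕ) (x : Fin (n + 1) → X) (l : Fin (n + 1) → ι × Bool),
      IsReducedCycle (fun i x y => y = F i • x) x l → x 0 ∈ cl ∅ := by
    intro n x l h
    choose A hA hxA using fun k => hcl.exists_finite (x k)
    have hfin : (⋃ k, A k).Finite := Set.finite_iUnion hA
    choose m hm using hdom
    obtain ⟨N, hN⟩ := ((Set.finite_univ (α := ι)).image2 m hfin).bddAbove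
    have hsub : ∀ i k, x k ∈ cl ((p N).dom i) := fun i k =>
      hcl.mono (fun a ha => ((hmono (hN ⟨i, trivial, a, Set.mem_iUnion.2 ⟨k, ha⟩, rfl⟩)) i).1
        (hm i a)) (hxA k)
    refine (p N).acyclic F (fun i a ha => hF i N a ha) n x l fun k => ⟨?_, (h k).2⟩
    have hk := (h k).1
    rcases hl : l k with ⟨i, _ | _⟩
    · rw [hl] at hk
      exact ⟨hsub i _, hk⟩
    · rw [hl] at hk
      exact ⟨hsub i _, hk⟩
  refine ⟨F, fun u hu x hx hux => ?_⟩
  let L := u.toWord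
  let c : FreeGroup ι := FreeGroup.mk (reduceCyclically.conjugator L)
  let r : FreeGroup ι := FreeGroup.mk (reduceCyclically L)
  have hur : u = c * r * c⁻¹ := by
    rw [FreeGroup.inv_mk, FreeGroup.mul_mk, FreeGroup.mul_mk,
      reduceCyclically.conj_conjugator_reduceCyclically, FreeGroup.mk_toWord]
  have hr : reduceCyclically L ≠ [] := by
    intro h
    have h1 : r = 1 := by
      simp only [r, h]
      rfl
    rw [h1] at hur
    simp [hu] at hur
  have hfix : FreeGroup.lift F r • (FreeGroup.lift F c)⁻¹ • x = (FreeGroup.lift F c)⁻¹ • x := by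
    rw [eq_inv_smul_iff, ← mul_smul, ← mul_smul, ← _root_.map_inv, ← _root_.map_mul,
      ← _root_.map_mul, ← hur, hux]
  obtain ⟨n, y, l, hy, hcyc⟩ :=
    (reduceCyclically.isCyclicallyReduced FreeGroup.isReduced_toWord).exists_isReducedCycle hr hfix
  have := hacyclic n y l hcyc
  rw [hy, hcl.smul_mem_empty_iff] at this
  exact hx this

end FreeActions

/-! ### Algebraic closure over the empty set and `M^eq` -/

namespace MSLanguage

section ImaginaryClosure

variable {S : Type u} {L : MSLanguage.{u, v} S} {M : S → Type w} [L.Structure M]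

/-- The algebraic closure of `A` in the imaginary sorts: the imaginaries algebraic over some finite
tuple of elements of `A`. -/
def imagAcl (A : Set (Σ s, M s)) : Set (Imag L M) :=
  {e | ∃ (β : Type) (_ : Finite β) (τ : β → S) (p : (b : β) → M (τ b)),
    (∀ b, (⟨τ b, p b⟩ : Σ s, M s) ∈ A) ∧ AlgOver p e}

theorem exists_tuple_of_finite {A : Set (Σ s, M s)} (hA : A.Finite) :
    ∃ (n : ℕ) (τ : Fin n → S) (p : (i : Fin n) → M (τ i)),
      (∀ i, (⟨τ i, p i⟩ : Σ s, M s) ∈ A) ∧ ∀ a ∈ A, ∃ i, a = ⟨τ i, p i⟩ := by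
  have := hA.to_subtype
  obtain ⟨n, ⟨f⟩⟩ := Finite.exists_equiv_fin A
  refine ⟨n, fun i => (f.symm i).1.1, fun i => (f.symm i).1.2, fun i => (f.symm i).2,
    fun a ha => ⟨f ⟨a, ha⟩, ?_⟩⟩
  change a = (f.symm (f ⟨a, ha⟩)).1
  rw [Equiv.symm_apply_apply]

theorem EqSort.algOver_self (E : EqSort L M) (x : (i : Fin E.arity) → M (E.dom i)) :
    AlgOver x (E.imag x) := by
  refine EqSort.algOver_imag_of_finite (τ := E.dom) (fun y v => E.rel y v) E.isDef
    (fun v => (Set.finite_singleton (E.imag v)).subset ?_) (E.rel.refl x)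
  rintro _ ⟨y, hy, rfl⟩
  exact EqSort.imag_eq_imag.2 hy

/-- Algebraic closure in the imaginary sorts satisfies the axioms of an independent closure for
the group of strong automorphisms. -/
theorem isIndependentClosure_imagAcl (hcount : Countable (Σ s, M s)) (hsat : IsSaturated L M) :
    IsIndependentClosure (strongAut L M) (imagAcl (L := L) (M := M)) where
  mono := fun A B hAB e ⟨β, hβ, τ, p, hp, he⟩ => ⟨β, hβ, τ, p, fun b => hAB (hp b), he⟩
  smul_mem := fun g A e ⟨β, hβ, τ, p, hp, he⟩ =>
    ⟨β, hβ, τ, fun b => g.1.1 _ (p b), fun b => ⟨_, hp b, rfl⟩, he.smul g.1⟩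
  exists_finite := fun e => by
    obtain ⟨E, x, rfl⟩ := e.exists_rep
    exact ⟨Set.range fun i => ⟨E.dom i, x i⟩, Set.finite_range _, Fin E.arity, inferInstance,
      E.dom, x, fun i => ⟨i, rfl⟩, E.algOver_self x⟩
  exists_smul := by
    rintro A B hA hBA ⟨s, d⟩
    obtain ⟨n, υ, a, -, ha⟩ := exists_tuple_of_finite hA
    obtain ⟨m, τ, b, hb, hb'⟩ := exists_tuple_of_finite (hA.subset hBA)
    obtain ⟨h, hh, he⟩ := exists_strongFixing_algOver hcount hsat a b d
    refine ⟨⟨h, hh.1⟩, fun c hc => ?_, fun e he₁ he₂ => ⟨Fin m, inferInstance, τ, b, hb,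
      he e ?_ ?_⟩⟩
    · obtain ⟨i, rfl⟩ := hb' c hc
      exact congrArg (Sigma.mk (τ i)) (hh.2 i)
    · obtain ⟨β, _, σ, p, hp, hpe⟩ := he₁
      refine hpe.of_subtuple fun c => ?_
      rcases hp c with hc | hc
      · exact ⟨none, hc⟩
      · obtain ⟨i, hi⟩ := hb' _ hc
        exact ⟨some i, hi⟩
    · obtain ⟨β, _, σ, p, hp, hpe⟩ := he₂
      refine hpe.of_subtuple fun c => ?_
      obtain ⟨i, hi⟩ := ha _ (hp c)
      exact ⟨.inl i, hi⟩
  exists_of_finite := by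
    intro Γ hΓ htot hsurj
    have hsort : ∀ q ∈ Γ, ∃ g : strongAut L M, g • q.1 = q.2 := fun q hq => by
      obtain ⟨g, hg⟩ := hΓ {q} (Set.singleton_subset_iff.2 hq) (Set.finite_singleton q)
      exact ⟨g, hg q rfl⟩
    have hpres : PreservesStrong L
        {t : Σ s, M s × M s | ((⟨t.1, t.2.1⟩ : Σ s, M s), (⟨t.1, t.2.2⟩ : Σ s, M s)) ∈ Γ} := by
      intro α _ σ x y hxy
      obtain ⟨g, hg⟩ := hΓ (Set.range fun a => ((⟨σ a, x a⟩ : Σ s, M s), (⟨σ a, y a⟩ : Σ s, M s)))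
        (Set.range_subset_iff.2 hxy) (Set.finite_range _)
      have : y = fun a => g.1.1 _ (x a) := funext fun a =>
        (eq_of_heq (Sigma.mk.inj (hg _ ⟨a, rfl⟩)).2).symm
      rw [this]
      exact g.2 α σ x
    obtain ⟨g, hg, hgΓ⟩ := hpres.exists_strongAut
      (fun s a => by
        obtain ⟨b, hb⟩ := htot ⟨s, a⟩
        obtain ⟨g, hg⟩ := hsort _ hb
        refine ⟨g.1.1 s a, ?_⟩
        rw [← show g • (⟨s, a⟩ : Σ s, M s) = b from hg] at hb
        exact hb)
      (fun s b => by
        obtain ⟨⟨s', a⟩, ha⟩ := hsurj ⟨s, b⟩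
        obtain ⟨g, hg⟩ := hsort _ ha
        obtain rfl : s' = s := congrArg Sigma.fst hg
        exact ⟨a, ha⟩)
    refine ⟨⟨g, hg⟩, ?_⟩
    rintro ⟨⟨s, a⟩, ⟨s', b⟩⟩ hab
    obtain ⟨k, hk⟩ := hsort _ hab
    obtain rfl : s = s' := congrArg Sigma.fst hk
    exact congrArg (Sigma.mk s) (hgΓ s a b hab)

/-- An imaginary algebraic over the empty set lies in a finite set of imaginaries given by a formula
without parameters. -/
theorem exists_formula_of_mem_imagAcl_empty {E : EqSort L M}
    {x : (i : Fin E.arity) → M (E.dom i)} (h : E.imag x ∈ imagAcl (L := L) (M := M) ∅) :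
    ∃ φ : Formula L (Fin E.arity) E.dom, φ.Realize x ∧ (E.imag '' {y | φ.Realize y}).Finite := by
  obtain ⟨β, _, τ, p, hp, he⟩ := h
  obtain ⟨P, hP, hx⟩ := algOver_imag_iff.1 he
  obtain ⟨φ, hφ⟩ := hP.isDef.comap (F := fun y : (i : Fin E.arity) → M (E.dom i) => pairVal y p) (by
    rintro (i | b)
    · exact ⟨i, rfl, fun _ => rfl⟩
    · exact (hp b).elim)
  refine ⟨φ, (hφ x).1 hx, (hP.finite p).subset ?_⟩
  rintro _ ⟨y, hy, rfl⟩
  exact ⟨y, (hφ y).2 hy, rfl⟩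

end ImaginaryClosure

section EqLanguage

variable {S : Type u} {L : MSLanguage.{u, v} S} {M : S → Type w} [L.Structure M]

theorem Term.exists_eqTerm {α : Type} {σ : α → S} {s : S} (t : Term L σ s) :
    ∃ t' : Term (eqLanguage L M) (fun a => Sum.inl (σ a)) (Sum.inl s),
      ∀ v : (a : α) → M (σ a), t'.realize (M := EqCarrier L M) v = t.realize v := by
  induction t with
  | var a => exact ⟨.var a, fun v => rfl⟩
  | @func n τ s f ts ih =>
    choose ts' h using ih
    refine ⟨.func (L := eqLanguage L M) (EqFn.home f) ts', fun v => ?_⟩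
    change Structure.funMap f (fun i => (ts' i).realize (M := EqCarrier L M) v) = _
    simp only [h]
    rfl

/-- Formulas of `L` can be read in the language of `M^eq`. -/
theorem IsDef.realize_eqLanguage {α : Type} {σ : α → S} (φ : Formula L α σ) :
    IsDef (eqLanguage L M) (M := EqCarrier L M) (σ := fun a => Sum.inl (σ a))
      (fun v : (a : α) → M (σ a) => φ.Realize v) := by
  induction φ with
  | falsum => exact IsDef.false
  | @equal α σ s t₁ t₂ =>
    obtain ⟨t₁', h₁⟩ := t₁.exists_eqTerm (M := M)
    obtain ⟨t₂', h₂⟩ := t₂.exists_eqTerm (M := M)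
    refine ⟨.equal t₁' t₂', fun v => ?_⟩
    exact ⟨fun h => (h₁ v).trans (h.trans (h₂ v).symm),
      fun h => (h₁ v).symm.trans (h.trans (h₂ v))⟩
  | rel R ts =>
    choose ts' h using fun i => (ts i).exists_eqTerm (M := M)
    refine ⟨.rel (L := eqLanguage L M) (EqRel.home R) ts', fun v => ?_⟩
    exact iff_of_eq (congrArg (Structure.RelMap R) (funext fun i => (h i v).symm))
  | imp φ ψ ihφ ihψ => exact ihφ.imp ihψ
  | @all α σ s φ ih =>
    refine IsDef.all (L := eqLanguage L M) (M := EqCarrier L M) (s := Sum.inl s)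
      (P := fun (x : EqCarrier L M (Sum.inl s)) (v : (a : α) → EqCarrier L M (Sum.inl (σ a))) =>
        φ.Realize (extendVal (M := M) (σ := σ) (s := s) x v))
      (ih.comap (F := fun v : (c : Option α) →
        EqCarrier L M (extend (fun a => Sum.inl (σ a)) (Sum.inl s) c) =>
          extendVal (M := M) (σ := σ) (s := s) (v none) fun a => v (some a)) ?_)
    rintro (_ | a)
    · exact ⟨none, rfl, fun _ => rfl⟩
    · exact ⟨some a, rfl, fun _ => rfl⟩

theorem EqSort.mem_acl_eqLanguage {E : EqSort L M} {x : (i : Fin E.arity) → M (E.dom i)}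
    (h : E.imag x ∈ imagAcl (L := L) (M := M) ∅) :
    (⟨Sum.inr E, Quotient.mk E.rel x⟩ : Σ s, EqCarrier L M s) ∈ acl (eqLanguage L M) ∅ := by
  obtain ⟨φ, hx, hfin⟩ := exists_formula_of_mem_imagAcl_empty h
  refine ⟨Quotient.mk E.rel '' {y | φ.Realize y}, ⟨0, Fin.elim0, fun i => i.elim0,
    fun i => i.elim0, ?_⟩, ?_, x, hx, rfl⟩
  · have hproj : IsDef (eqLanguage L M) (M := EqCarrier L M)
        (fun v : (c : Fin E.arity ⊕ Option (Fin 0)) → EqCarrier L M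
          (Sum.elim (fun i => Sum.inl (E.dom i)) (extend Fin.elim0 (Sum.inr E)) c) =>
          Quotient.mk E.rel (fun i => v (Sum.inl i)) = v (Sum.inr none)) :=
      ⟨.equal (L := eqLanguage L M) (s := Sum.inr E)
        (.func (L := eqLanguage L M) (EqFn.proj E) fun i => Term.var (Sum.inl i))
        (Term.var (Sum.inr none)),
        fun v => Iff.rfl⟩
    obtain ⟨ψ, hψ⟩ := IsDef.exists_tuple (L := eqLanguage L M) (M := EqCarrier L M)
      (σ := fun i => Sum.inl (E.dom i)) (τ := extend Fin.elim0 (Sum.inr E))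
      (P := fun (y : (i : Fin E.arity) → M (E.dom i)) v =>
        φ.Realize y ∧ Quotient.mk E.rel y = v none)
      (((IsDef.realize_eqLanguage φ).comap isReindex_lft).and hproj)
    refine ⟨ψ, ?_⟩
    ext q
    exact hψ (extendVal q fun i => i.elim0)
  · refine Set.Finite.of_finite_image (f := Sigma.mk (β := fun E : EqSort L M => Quotient E.rel) E)
      ?_ (sigma_mk_injective.injOn)
    refine hfin.subset ?_
    rintro _ ⟨_, ⟨y, hy, rfl⟩, rfl⟩
    exact ⟨y, hy, rfl⟩

variable (L M) in
/-- The sort `s`, as a sort of imaginaries: its quotient by equality. -/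
def eqSortOf (s : S) : EqSort L M where
  arity := 1
  dom _ := s
  rel := Setoid.ker fun x => x 0
  definable := ⟨.equal (s := s) (Term.var (Sum.inl 0)) (Term.var (Sum.inr 0)), fun _ _ => Iff.rfl⟩

/-- The element `a`, as an imaginary. -/
def imagOf {s : S} (a : M s) : Imag L M := (eqSortOf L M s).imag fun _ => a

theorem exists_formula_of_imagOf_mem {s : S} {a : M s}
    (h : imagOf a ∈ imagAcl (L := L) (M := M) ∅) :
    ∃ φ : Formula L (Fin 1) (fun _ => s), φ.Realize (M := M) (fun _ => a) ∧
      {b : M s | φ.Realize (M := M) (fun _ => b)}.Finite := by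
  obtain ⟨φ, ha, hfin⟩ := exists_formula_of_mem_imagAcl_empty h
  refine ⟨φ, ha, (Set.Finite.subset hfin ?_).of_finite_image (f := imagOf (L := L))
    fun b _ c _ hbc => ?_⟩
  · rintro _ ⟨b, hb, rfl⟩
    exact ⟨fun _ => b, hb, rfl⟩
  · exact EqSort.imag_eq_imag.1 hbc

theorem imagOf_mem_acl_eqLanguage {s : S} {a : M s}
    (h : imagOf a ∈ imagAcl (L := L) (M := M) ∅) :
    (⟨Sum.inl s, a⟩ : Σ s, EqCarrier L M s) ∈ acl (eqLanguage L M) ∅ := by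
  obtain ⟨φ, ha, hfin⟩ := exists_formula_of_imagOf_mem h
  refine ⟨{b : M s | φ.Realize (M := M) fun _ => b}, ⟨0, Fin.elim0, fun i => i.elim0,
    fun i => i.elim0, ?_⟩, hfin, ha⟩
  obtain ⟨ψ, hψ⟩ := (IsDef.realize_eqLanguage (M := M) φ).comap
    (τ := extend Fin.elim0 (Sum.inl s)) (F := fun v _ => v none)
    (fun _ => ⟨none, rfl, fun _ => rfl⟩)
  refine ⟨ψ, ?_⟩
  ext b
  exact hψ (extendVal b fun i => i.elim0)

/-- In a saturated structure, an infinite sort has a non-algebraic element. -/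
theorem exists_imagOf_notMem (hsat : IsSaturated L M) {s : S} (hs : Infinite (M s)) :
    ∃ a : M s, imagOf a ∉ imagAcl (L := L) (M := M) ∅ := by
  obtain ⟨a, ha⟩ := hsat.exists_forall_one (β := PEmpty) (τ := fun b => b.elim) (s := s)
    (fun b => b.elim) (I := {φ : Formula L (Fin 1) (fun _ => s) //
      {b : M s | φ.Realize (M := M) (fun _ => b)}.Finite})
    (P := fun φ a _ => ¬ φ.1.Realize (M := M) (fun _ => a))
    (fun φ => ((IsDef.realize φ.1).comap
      (F := fun (v : (c : Option PEmpty) → M (extend (fun b : PEmpty => b.elim) s c)) (_ : Fin 1) =>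
        (v none : M s))
      fun _ => ⟨none, rfl, fun _ => rfl⟩).not)
    (fun T => by
      obtain ⟨a, ha⟩ := (T.finite_toSet.biUnion fun φ _ => φ.2).exists_notMem
      exact ⟨a, fun φ hφ h => ha (Set.mem_iUnion₂.2 ⟨φ, hφ, h⟩)⟩)
  refine ⟨a, fun h => ?_⟩
  obtain ⟨φ, hφ, hfin⟩ := exists_formula_of_imagOf_mem h
  exact ha ⟨φ, hfin⟩ hφ

end EqLanguage

end MSLanguage

open MSLanguage in
theorem corollary3p4 {S : Type u} (L : MSLanguage.{u, v} S) (M : S → Type w)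
    [L.Structure M] (hcount : Countable (Σ s, M s)) (hsat : MSLanguage.IsSaturated L M)
    (hinf : ∃ s, Infinite (M s)) :
    ∃ f g : MSLanguage.Aut L M,
      f ∈ MSLanguage.autFixing L M (MSLanguage.acl L ∅) ∧
      g ∈ MSLanguage.autFixing L M (MSLanguage.acl L ∅) ∧
      Function.Injective (FreeGroup.lift ![f, g] : FreeGroup (Fin 2) →* MSLanguage.Aut L M) ∧
      ∀ h ∈ Subgroup.closure {f, g}, h ≠ 1 →
        ∀ (s : S ⊕ MSLanguage.EqSort L M) (e : MSLanguage.EqCarrier L M s),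
          (⟨s, e⟩ : Σ s, MSLanguage.EqCarrier L M s) ∉
            MSLanguage.acl (MSLanguage.eqLanguage L M) ∅ →
          (MSLanguage.autEq L M h).1 s e ≠ e := by
  obtain ⟨F, hF⟩ := (isIndependentClosure_imagAcl hcount hsat).exists_free (Fin 2)
  have hlift : ∀ u, FreeGroup.lift ![(F 0).1, (F 1).1] u = (FreeGroup.lift F u).1 := by
    have : FreeGroup.lift ![(F 0).1, (F 1).1] =
        (strongAut L M).subtype.comp (FreeGroup.lift F) := by
      ext i : 1
      fin_cases i <;> simp
    exact fun u => DFunLike.congr_fun this u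
  refine ⟨(F 0).1, (F 1).1, strongAut_le_autFixing (F 0).2, strongAut_le_autFixing (F 1).2, ?_, ?_⟩
  · obtain ⟨s, hs⟩ := hinf
    obtain ⟨a, ha⟩ := exists_imagOf_notMem hsat hs
    refine (injective_iff_map_eq_one _).2 fun u hu => ?_
    by_contra hne
    rw [hlift, OneMemClass.coe_eq_one] at hu
    exact hF u hne _ ha (by rw [hu, one_smul])
  · intro h hh hne s e he hfix
    obtain ⟨u, rfl⟩ : ∃ u, FreeGroup.lift ![(F 0).1, (F 1).1] u = h := by
      rw [← MonoidHom.mem_range, FreeGroup.range_lift_eq_closure]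
      simpa [Matrix.range_cons, Set.pair_comm] using hh
    have hu : u ≠ 1 := by
      rintro rfl
      exact hne (map_one _)
    rw [hlift] at hfix
    rcases s with s | E
    · refine hF u hu (imagOf (s := s) e) (fun hmem => he (imagOf_mem_acl_eqLanguage hmem)) ?_
      exact congrArg (imagOf (L := L) (M := M)) hfix
    · induction e using Quotient.inductionOn with | h x => ?_
      exact hF u hu (E.imag x) (fun hmem => he (EqSort.mem_acl_eqLanguage hmem))
        (congrArg (Sigma.mk E) hfix)
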